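/- A knot projection $P$ is the image of a generic immersion of a circle into the sphere $S^2$ with at least one double point, considered up to homeomorphism of $S^2$, i.e. the spherical 4-valent map that it draws. A double point $v$ of a closed curve is nugatory if some simple closed curve on $S^2$ meets the curve only in $v$ and has two of the four arms at $v$ on each side; $P$ is reducible if it has a nugatory double point, and reduced otherwise. The non-Seifert splice at a double point removes it, joining (for an orientation of $P$, the choice of which does not matter) its two incoming arms to each other and its two outgoing arms to each other. Let $y(P)\in\mathbb N\cup\{\infty\}$ be the minimal size of a set $S$ of double points of $P$ such that applying the non-Seifert splices of $P$ at all points of $S$ simultaneously yields a reducible knot projection (in particular, a single closed curve). By a circle through given double points of $P$ we mean a simple closed curve on $S^2$ that meets $P$ exactly in these points and, at each of them, passes between opposite sectors, so that two arms lie on either side. Running along $P$, one changes the side of the circle at each visit to one of these points. Theorem. Let $P$ be a reduced knot projection. Then $y(P)=2$ if and only if the following two conditions hold. 1. There is no circle through exactly two double points $a,b$ of $P$ such that all four arcs into which $a,b$ cut $P$ join $a$ to $b$, i.e. such that $P$ visits these points in the cyclic order $a,b,a,b$. 2. There is a circle through exactly three double points $m,a,b$ of $P$ such that $P$ visits these points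 in the cyclic order $m,a,b,m,b,a$ (so each side of the circle contains one arc of $P$ between $m$ and $a$, one between $a$ and $b$, and one between $b$ and $m$). -/

import Mathlib

open Equiv

/-- The number of orbits of a permutation (fixed points count as orbits). -/
noncomputable def orbitCount {D : Type*} (f : Perm D) : ℕ :=
  Nat.card (Quotient (Perm.SameCycle.setoid f))

/-- A knot projection: (the image of) a generic immersion of one circle into the oriented sphere
`S²` with at least one double point, given up to homeomorphism by the 4-valent map that it
draws on the sphere.

`D` is the set of darts: a dart is an edge-end at a double point, thought of as an arm pointing
away from that double point.  `rot` turns an arm counterclockwise to the next arm at the same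
double point, and `edge` exchanges the two ends of an edge.
* Every double point has exactly four arms (`rot_four`, `rot_two_ne`).
* `rot (rot d)` is the arm opposite to `d`, so the immersed curve runs along edges and goes
  straight through double points; `one_component` says that it is one closed curve.
* A face is an orbit of `rot⁻¹ * edge` (see `KnotProjection.Face`), and `spherical` is Euler's
  formula `V + F = E + 2` for a connected map on the sphere. -/
structure KnotProjection (D : Type*) [Finite D] where
  rot : Perm D
  edge : Perm D
  nonempty : Nonempty D
  rot_four : ∀ d, rot (rot (rot (rot d))) = d
  rot_two_ne : ∀ d, rot (rot d) ≠ d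
  edge_edge : ∀ d, edge (edge d) = d
  edge_ne : ∀ d, edge d ≠ d
  one_component : ∀ d e, Relation.EqvGen (fun a b => b = edge a ∨ b = rot (rot a)) d e
  spherical : orbitCount rot + orbitCount (rot⁻¹ * edge) = orbitCount edge + 2

namespace KnotProjection

variable {D : Type*} [Finite D] (P : KnotProjection D)

/-- The double points of the projection. -/
def Crossing : Type _ := Quotient (Perm.SameCycle.setoid P.rot)

/-- The double point at which a dart is based. -/
def crossing (d : D) : P.Crossing := Quotient.mk (Perm.SameCycle.setoid P.rot) d

/-- The arm opposite to `d` at its double point. -/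
def opp (d : D) : D := P.rot (P.rot d)

/-- A dart `d` also names a corner: the sector between the arms `d` and `rot d`.  Going along the
edge of `d` with that sector on the left, one arrives at the sector between
`rot⁻¹ (edge d)` and `edge d`.  So the orbits of `faceNext` are the boundary walks of
the faces, the connected components of the complement of the projection. -/
def faceNext : Perm D := P.rot⁻¹ * P.edge

/-- The faces: the components of the complement of the projection in the sphere. -/
def Face : Type _ := Quotient (Perm.SameCycle.setoid P.faceNext)

/-- The face in which the corner between `d` and `rot d` lies. -/
def face (d : D) : P.Face := Quotient.mk (Perm.SameCycle.setoid P.faceNext) d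

/-- Leave a double point along the arm `d`, follow the edge to the next double point, go straight
through it: the arm along which that double point is left. -/
def travel : Perm D := P.edge.trans (P.rot.trans P.rot)

/-- `d` and `e` are directed alike by an orientation of the curve: both are left or both are
entered when the curve is run through in one of its two directions. -/
def SameDirection (d e : D) : Prop := P.travel.SameCycle d e

/-- The arm to which the arm `d` gets joined by the non-Seifert splice at its double point: it is
the arm next to `d` that is directed like `d`, so two incoming arms are joined to each
other, and two outgoing arms. -/
noncomputable def nonSeifertTurn (d : D) : D := by
  classical exact if P.SameDirection d (P.rot d) then P.rot d else P.rot⁻¹ d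

/-! ### Simultaneous non-Seifert splices

For a set `S` of double points, let `P_S` be the result of applying the non-Seifert splices
(with respect to the curve `P` itself) at all points of `S` simultaneously.  The splices take place
in small disks around the points of `S`, so `P_S` is described on the sphere by the arcs
and the faces of `P`: at points of `S` arms are joined by `nonSeifertTurn` and not straight, and
the two opposite corners between differently directed arms are united to one region. -/

/-- The arm that follows the arm `d` in `P_S` at its double point. -/
noncomputable def splicedTurn (S : Finset P.Crossing) (d : D) : D := by
  classical exact if P.crossing d ∈ S then P.nonSeifertTurn d else P.opp d

/-- `P_S` is a single closed curve. -/
def IsOneCurveAfter (S : Finset P.Crossing) : Prop :=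
  ∀ d e, Relation.EqvGen (fun a b => b = P.edge a ∨ b = P.splicedTurn S a) d e

/-- The corners named by `d` and `e` lie in the same component of the complement of `P_S`: they are
linked by corners of common faces and by the passages opened by the splices. -/
def SameRegionAfter (S : Finset P.Crossing) (d e : D) : Prop :=
  Relation.EqvGen (fun a b => P.face a = P.face b ∨
    (P.crossing a ∈ S ∧ ¬ P.SameDirection a (P.rot a) ∧ b = P.opp a)) d e

/-- The double point `v` is (still a double point and) a nugatory crossing of `P_S`: some simple
closed curve meets `P_S` in `v` only and has two arms of `v` on each side.  In other
words, two opposite corners at `v` lie in the same component of the complement of `P_S`. -/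
def IsNugatoryAfter (S : Finset P.Crossing) (v : P.Crossing) : Prop :=
  v ∉ S ∧ ∃ d, P.crossing d = v ∧ P.SameRegionAfter S d (P.opp d)

/-- `P_S` is a reducible knot projection: one closed curve, with a nugatory crossing. -/
def IsReducibleAfter (S : Finset P.Crossing) : Prop :=
  P.IsOneCurveAfter S ∧ ∃ v, P.IsNugatoryAfter S v

/-- A knot projection is reducible if it has a nugatory crossing (and reduced otherwise). -/
def IsReducible : Prop := P.IsReducibleAfter ∅

/-- The minimal number of non-Seifert splices that, applied simultaneously, yield a reducible knot
projection (`⊤` if there is no such set of splices). -/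
noncomputable def y : ℕ∞ :=
  ⨅ (S : Finset P.Crossing) (_ : P.IsReducibleAfter S), (S.card : ℕ∞)

/-! ### Circles through double points -/

/-- `c` describes a simple closed curve on the sphere that meets `P` in exactly `k` double points,
and goes at each of them from a corner to the opposite corner, with two arms on either side:
it visits the distinct double points of `c 0, …, c (k - 1)` in this cyclic order, leaves
the `i`-th one through the corner `c i`, crosses the face there, and enters the next
one through the corner opposite to `c (i + 1)`.  It runs through every face at
most once.  (In a reduced projection that is no condition for `k ≤ 3`, as
opposite corners then lie in different faces.) -/
def IsCircleThrough {k : ℕ} [NeZero k] (c : Fin k → D) : Prop :=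
  Function.Injective (fun i => P.crossing (c i)) ∧
  Function.Injective (fun i => P.face (c i)) ∧
  ∀ i, P.face (c i) = P.face (P.opp (c (i + 1)))

/-- The double points in the order in which they are met when the curve is run through once,
starting along the arm `d`.  Every double point is met twice, so the length is the number of
edges. -/
noncomputable def gaussWord (d : D) : List P.Crossing :=
  (List.range (Nat.card D / 2)).map fun i => P.crossing ((P.travel ^ i) d)

/-- Running once through the curve from a suitable start, one meets the double points of `w` in the
order `w` (each of them has to be listed twice in `w`).  This says to which point the curve
leads from each of them, between any two successive visits to them. -/
def MeetsInCyclicOrder (w : List P.Crossing) : Prop :=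
  ∃ d, w.Sublist (P.gaussWord d)

/-- There is a circle that meets `P` in exactly two double points `a`, `b`, such that on each side of
the circle the two arcs of `P` both join `a` to `b`.  As `P` changes the side at each visit to
`a` or `b`, this means that it runs `a → b → a → b → a`. -/
def HasTwoPointCircle : Prop :=
  ∃ c : Fin 2 → D, P.IsCircleThrough c ∧
    ∃ a b : P.Crossing, ({a, b} : Set P.Crossing) = Set.range (fun i => P.crossing (c i)) ∧
      P.MeetsInCyclicOrder [a, b, a, b]

/-- There is a circle that meets `P` in exactly three double points `m`, `a`, `b`, such that the six
arcs into which these points cut `P`, alternately on the two sides of the circle, are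
traversed as `m → a → b → m → b → a → m`.  So on each side there is an arc from `m` to `a`, one
from `a` to `b` and one from `b` to `m`. -/
def HasThreePointCircle : Prop :=
  ∃ c : Fin 3 → D, P.IsCircleThrough c ∧
    ∃ m a b : P.Crossing, ({m, a, b} : Set P.Crossing) = Set.range (fun i => P.crossing (c i)) ∧
      P.MeetsInCyclicOrder [m, a, b, m, b, a]

end KnotProjection

/-! A non-Seifert splice at `a` opens a passage between the two opposite sectors at `a` that lie
between differently directed arms, so the regions of `P_S` are the faces of `P` glued along the
passages at `S`. In a reduced projection opposite sectors lie in different faces. Hence a nugatory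
point `v` of `P_S`, for `S` of size at most two, yields a chain of faces through one or two passages
from a sector of `v` to the opposite one. It closes up to a circle through `v` and those points of
`S`, and at the latter it passes between differently directed arms. Conversely, such a circle makes
`v` nugatory.

Which circles these are can be read off the cyclic order of visits. A circle has two sides
(`exists_side`, the vanishing of the first cohomology of the sphere mod 2, obtained from Euler's
formula), and the curve changes side exactly at its visits to the circle's points. The circle passes
between differently directed arms at `a` iff both outgoing arms at `a` lie on one side
(`IsSide.nonSeifertTurn_iff`), that is, iff an odd number of visits to the other points falls
between the two visits to `a`.

For two points this says that they are interlaced. One splice always leaves one curve, so the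
forbidden two-point circle is exactly what makes one splice suffice (`two_le_y_iff`). For three
points `m`, `a`, `b` with the parity condition at `a` and `b`, either `a` and `b` are interlaced
with each other and not with `m`, or both are interlaced with `m` and not with each other. Splicing
two interlaced points yields two curves, which excludes the first case; the second is the order `m,
a, b, m, b, a`, and there the splices at `a` and `b` do leave one curve. -/

theorem eq_of_eqvGen {α β : Type*} {r : α → α → Prop} {φ : α → β}
    (hr : ∀ a b, r a b → φ a = φ b) {x y : α} (h : Relation.EqvGen r x y) : φ x = φ y := by
  induction h with
  | rel x y h => exact hr x y h
  | refl => rfl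
  | symm _ _ _ ih => exact ih.symm
  | trans _ _ _ _ _ ih ih' => exact ih.trans ih'

/-! ### Arms and corners at a double point -/

namespace KnotProjection

variable {D : Type*} [Finite D] (P : KnotProjection D)

theorem opp_opp (d : D) : P.opp (P.opp d) = d := P.rot_four d

theorem opp_ne (d : D) : P.opp d ≠ d := P.rot_two_ne d

theorem rot_rot (d : D) : P.rot (P.rot d) = P.opp d := rfl

theorem rot_opp (d : D) : P.rot (P.opp d) = P.opp (P.rot d) := rfl

theorem rot_inv (d : D) : P.rot⁻¹ d = P.opp (P.rot d) := by
  rw [Perm.inv_eq_iff_eq]; exact (P.rot_four d).symm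

theorem travel_apply (d : D) : P.travel d = P.opp (P.edge d) := rfl

theorem crossing_rot (d : D) : P.crossing (P.rot d) = P.crossing d :=
  Quotient.sound (Perm.sameCycle_apply_left.2 (Perm.SameCycle.refl _ _))

theorem crossing_opp (d : D) : P.crossing (P.opp d) = P.crossing d := by
  rw [opp, crossing_rot, crossing_rot]

theorem crossing_eq_iff (d e : D) : P.crossing d = P.crossing e ↔
    e = d ∨ e = P.rot d ∨ e = P.opp d ∨ e = P.opp (P.rot d) := by
  constructor
  · intro h
    obtain ⟨i, hi⟩ := (Quotient.exact h : P.rot.SameCycle d e)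
    have h4 : P.rot ^ 4 = 1 := by ext x; exact P.rot_four x
    have : P.rot ^ i = P.rot ^ (i % 4) := by
      conv_lhs => rw [← Int.emod_add_mul_ediv i 4, zpow_add, zpow_mul]
      have : P.rot ^ (4 : ℤ) = 1 := by exact_mod_cast h4
      rw [this, one_zpow, mul_one]
    rw [this] at hi
    have h0 := Int.emod_nonneg i (show (4 : ℤ) ≠ 0 by norm_num)
    have h1 := Int.emod_lt_of_pos i (show (0 : ℤ) < 4 by norm_num)
    generalize i % 4 = j at *
    interval_cases j
    · left; exact hi.symm
    · right; left; exact hi.symm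
    · right; right; left; exact hi.symm
    · right; right; right; exact hi.symm
  · rintro (rfl | rfl | rfl | rfl) <;> simp [crossing_rot, crossing_opp]

theorem face_faceNext (d : D) : P.face (P.faceNext d) = P.face d :=
  Quotient.sound (Perm.sameCycle_apply_left.2 (Perm.SameCycle.refl _ _))

/-! ### The two directions -/

theorem sameDirection_refl (d : D) : P.SameDirection d d := Perm.SameCycle.refl _ _

variable {P} in
theorem SameDirection.symm {d e : D} (h : P.SameDirection d e) : P.SameDirection e d :=
  Perm.SameCycle.symm h

variable {P} in
theorem SameDirection.trans {d e f : D} (h : P.SameDirection d e) (h' : P.SameDirection e f) :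
    P.SameDirection d f :=
  Perm.SameCycle.trans h h'

theorem sameDirection_travel (d e : D) : P.SameDirection d (P.travel e) ↔ P.SameDirection d e :=
  Perm.sameCycle_apply_right

/-- Reversing an edge reverses the run: `edge` conjugates `travel` to its inverse. -/
theorem edge_travel_zpow (n : ℤ) (d : D) :
    P.edge ((P.travel ^ n) d) = (P.travel ^ (-n)) (P.edge d) := by
  have hi : P.edge⁻¹ = P.edge := by
    ext x; rw [Perm.inv_eq_iff_eq]; exact (P.edge_edge x).symm
  have h : P.edge * P.travel * P.edge⁻¹ = P.travel⁻¹ := by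
    rw [eq_inv_iff_mul_eq_one]
    ext x
    simp [hi, travel_apply, P.edge_edge, P.opp_opp]
  have h2 : P.edge * P.travel ^ n * P.edge⁻¹ = P.travel ^ (-n) := by
    rw [← conj_zpow, h, zpow_neg, inv_zpow]
  rw [← h2]; simp

/-- Otherwise the reversal would reflect a single cycle of `travel`. The midpoint between `d` and
`edge d` would then give an arm fixed by `edge` (even distance) or by `opp` (odd distance). -/
theorem not_sameDirection_edge_self (d : D) : ¬ P.SameDirection d (P.edge d) := by
  rintro ⟨k, hk⟩
  obtain ⟨j, rfl | rfl⟩ := Int.even_or_odd' k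
  · apply P.edge_ne ((P.travel ^ j) d)
    rw [edge_travel_zpow, ← hk, ← Perm.mul_apply, ← zpow_add]
    congr 2; ring
  · apply P.opp_ne (P.edge ((P.travel ^ j) d))
    rw [← travel_apply, edge_travel_zpow, ← hk, ← Perm.mul_apply, ← Perm.mul_apply, ← zpow_add,
      ← zpow_one_add]
    congr 2; ring

/-- The orbit of `d` together with its reversal is closed under `edge` and `opp`, so it is
everything, the curve being connected. -/
theorem sameDirection_or (d e : D) : P.SameDirection d e ∨ P.SameDirection d (P.edge e) := by
  have h := P.one_component d e
  have key : ∀ a b : D, (b = P.edge a ∨ b = P.rot (P.rot a)) →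
      ((P.SameDirection d a ∨ P.SameDirection d (P.edge a)) ↔
        (P.SameDirection d b ∨ P.SameDirection d (P.edge b))) := by
    rintro a b (rfl | rfl)
    · rw [P.edge_edge, or_comm]
    · have h1 : P.SameDirection d (P.opp a) ↔ P.SameDirection d (P.edge a) := by
        rw [← sameDirection_travel P d (P.edge a), travel_apply, P.edge_edge]
      have h2 : P.SameDirection d (P.edge (P.opp a)) ↔ P.SameDirection d a := by
        rw [← sameDirection_travel, travel_apply, P.edge_edge, P.opp_opp]
      change _ ↔ P.SameDirection d (P.opp a) ∨ P.SameDirection d (P.edge (P.opp a))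
      rw [h1, h2, or_comm]
  rw [← eq_of_eqvGen (φ := fun x => P.SameDirection d x ∨ P.SameDirection d (P.edge x))
    (fun a b hab => propext (key a b hab)) h]
  exact Or.inl (P.sameDirection_refl d)

theorem sameDirection_edge (d e : D) : P.SameDirection d (P.edge e) ↔ ¬ P.SameDirection d e :=
  ⟨fun h h' => P.not_sameDirection_edge_self e (h'.symm.trans h),
    fun h => (P.sameDirection_or d e).resolve_left h⟩

theorem sameDirection_opp (d e : D) : P.SameDirection d (P.opp e) ↔ ¬ P.SameDirection d e := by
  rw [← sameDirection_edge, ← sameDirection_travel P d (P.edge e), travel_apply, P.edge_edge]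

theorem opp_sameDirection (d e : D) : P.SameDirection (P.opp d) e ↔ ¬ P.SameDirection d e := by
  have h1 : P.SameDirection (P.opp d) e ↔ P.SameDirection e (P.opp d) :=
    ⟨fun h => h.symm, fun h => h.symm⟩
  have h2 : P.SameDirection d e ↔ P.SameDirection e d :=
    ⟨fun h => h.symm, fun h => h.symm⟩
  rw [h1, h2, sameDirection_opp]

/-! ### The non-Seifert turn -/

theorem nonSeifertTurn_opp (d : D) : P.nonSeifertTurn (P.opp d) = P.opp (P.nonSeifertTurn d) := by
  have h : P.SameDirection (P.opp d) (P.rot (P.opp d)) ↔ P.SameDirection d (P.rot d) := by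
    rw [rot_opp, sameDirection_opp, opp_sameDirection, not_not]
  unfold nonSeifertTurn
  by_cases h' : P.SameDirection d (P.rot d)
  · rw [if_pos h', if_pos (h.2 h'), rot_opp]
  · rw [if_neg h', if_neg (mt h.1 h'), rot_inv, rot_inv, rot_opp]

/-- The arms at a double point that have the direction of `d` are `d` and `nonSeifertTurn d`. -/
theorem eq_or_eq_nonSeifertTurn {d e : D} (h : P.crossing d = P.crossing e)
    (hd : P.SameDirection d e) : e = d ∨ e = P.nonSeifertTurn d := by
  rw [crossing_eq_iff] at h
  unfold nonSeifertTurn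
  rcases h with rfl | rfl | rfl | rfl
  · simp
  · simp [hd]
  · exact absurd (P.sameDirection_refl d) ((P.sameDirection_opp _ _).1 hd)
  · rw [if_neg ((P.sameDirection_opp _ _).1 hd), rot_inv]; simp

theorem rot_ne (d : D) : P.rot d ≠ d := fun h => P.rot_two_ne d (by rw [h, h])

theorem nonSeifertTurn_ne (d : D) : P.nonSeifertTurn d ≠ d := by
  unfold nonSeifertTurn
  split_ifs
  · exact P.rot_ne d
  · rw [Ne, Perm.inv_eq_iff_eq]; exact (P.rot_ne d).symm

theorem crossing_nonSeifertTurn (d : D) : P.crossing (P.nonSeifertTurn d) = P.crossing d := by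
  unfold nonSeifertTurn
  split_ifs <;> simp [rot_inv, crossing_rot, crossing_opp]

theorem sameDirection_nonSeifertTurn (d : D) : P.SameDirection d (P.nonSeifertTurn d) := by
  unfold nonSeifertTurn
  split_ifs with h
  · exact h
  · rw [rot_inv, sameDirection_opp]; exact h

/-! ### The darts in the order of the curve -/

/-- Half the number of darts, which is the number of edges. -/
noncomputable def length (_ : KnotProjection D) : ℕ := Nat.card D / 2

/-- The `i`-th arm along which a double point is left, starting from the arm `d`. -/
def dart (d : D) (i : ℕ) : D := (P.travel ^ i) d

theorem dart_zero (d : D) : P.dart d 0 = d := rfl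

theorem dart_succ (d : D) (i : ℕ) : P.dart d (i + 1) = P.opp (P.edge (P.dart d i)) := by
  rw [dart, pow_succ', Perm.mul_apply, travel_apply, dart]

theorem opp_dart_succ (d : D) (i : ℕ) : P.opp (P.dart d (i + 1)) = P.edge (P.dart d i) := by
  rw [dart_succ, opp_opp]

theorem dart_dart (d : D) (i j : ℕ) : P.dart (P.dart d i) j = P.dart d (i + j) := by
  rw [dart, dart, dart, add_comm, pow_add, Perm.mul_apply]

theorem sameDirection_dart (d : D) (i : ℕ) : P.SameDirection d (P.dart d i) := ⟨i, rfl⟩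

/-- The orbit of `d` and its image under `edge` are disjoint and exhaust the darts, so each is half
of them. Hence a Gauss word is exactly one round of the curve. -/
theorem minimalPeriod_travel (d : D) : Function.minimalPeriod P.travel d = P.length := by
  set N := Function.minimalPeriod P.travel d with hN
  have hiter : ∀ i, (⇑P.travel)^[i] d = P.dart d i := fun i => by rw [dart, Perm.iterate_eq_pow]
  let f : Fin N × Bool → D := fun p => if p.2 then P.dart d p.1 else P.edge (P.dart d p.1)
  have hinj : ∀ i j : Fin N, P.dart d i = P.dart d j → i = j := by
    intro i j h
    rw [← hiter, ← hiter] at h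
    exact Fin.ext (Function.iterate_injOn_Iio_minimalPeriod i.2 j.2 h)
  have hne : ∀ i j : ℕ, P.dart d i ≠ P.edge (P.dart d j) := fun i j h => by
    have := P.sameDirection_dart d i
    rw [h, sameDirection_edge] at this
    exact this (P.sameDirection_dart d j)
  have hpos : 0 < N := by
    rw [hN, Function.minimalPeriod_pos_iff_mem_periodicPts]
    exact P.travel.injective.mem_periodicPts d
  have hsurj : ∀ e, P.SameDirection d e → ∃ i : Fin N, P.dart d i = e := by
    rintro e he
    obtain ⟨i, rfl⟩ := he.exists_nat_pow_eq
    refine ⟨⟨i % N, Nat.mod_lt _ hpos⟩, ?_⟩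
    rw [← hiter, Function.iterate_mod_minimalPeriod_eq, hiter]; rfl
  have hf : Function.Bijective f := by
    constructor
    · rintro ⟨i, b⟩ ⟨j, c⟩ h
      cases b <;> cases c <;> simp only [f, if_true, if_false, Bool.false_eq_true] at h
      · rw [hinj i j (P.edge.injective h)]
      · exact absurd h.symm (hne _ _)
      · exact absurd h (hne _ _)
      · rw [hinj i j h]
    · intro e
      rcases P.sameDirection_or d e with h | h
      · obtain ⟨i, hi⟩ := hsurj _ h
        exact ⟨(i, true), by simpa [f] using hi⟩
      · obtain ⟨i, hi⟩ := hsurj _ h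
        exact ⟨(i, false), by simp [f, hi, P.edge_edge]⟩
  have := Nat.card_congr (Equiv.ofBijective f hf)
  rw [Nat.card_prod] at this
  simp at this
  rw [length, ← this]; omega

theorem length_pos : 0 < P.length := by
  obtain ⟨d⟩ := P.nonempty
  rw [← P.minimalPeriod_travel d, Function.minimalPeriod_pos_iff_mem_periodicPts]
  exact P.travel.injective.mem_periodicPts d

theorem dart_add_length (d : D) (i : ℕ) : P.dart d (i + P.length) = P.dart d i := by
  have := Function.iterate_add_minimalPeriod_eq (f := P.travel) (x := d) (n := i)
  rwa [minimalPeriod_travel, Perm.iterate_eq_pow, Perm.iterate_eq_pow] at this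

theorem dart_length (d : D) : P.dart d P.length = d := by
  have := P.dart_add_length d 0
  rwa [zero_add] at this

theorem dart_inj {d : D} {i j : ℕ} (hi : i < P.length) (hj : j < P.length)
    (h : P.dart d i = P.dart d j) : i = j := by
  rw [← P.minimalPeriod_travel d] at hi hj
  simp only [dart, ← Perm.iterate_eq_pow] at h
  exact Function.iterate_injOn_Iio_minimalPeriod hi hj h

theorem exists_dart_eq {d e : D} (h : P.SameDirection d e) : ∃ i < P.length, P.dart d i = e := by
  obtain ⟨i, rfl⟩ := h.exists_nat_pow_eq
  refine ⟨i % P.length, Nat.mod_lt _ P.length_pos, ?_⟩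
  rw [← P.minimalPeriod_travel d, dart, ← Perm.iterate_eq_pow,
    Function.iterate_mod_minimalPeriod_eq, Perm.iterate_eq_pow]

theorem dart_ne_edge_dart (d : D) (i j : ℕ) : P.dart d i ≠ P.edge (P.dart d j) := fun h => by
  have := P.sameDirection_dart d i
  rw [h, sameDirection_edge] at this
  exact this (P.sameDirection_dart d j)

theorem sameDirection_dart_dart (d : D) (i j : ℕ) : P.SameDirection (P.dart d i) (P.dart d j) :=
  (P.sameDirection_dart d i).symm.trans (P.sameDirection_dart d j)

/-- Two different visits to a double point are exchanged by the non-Seifert turn. -/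
theorem nonSeifertTurn_dart {d : D} {i j : ℕ} (h : P.crossing (P.dart d i) = P.crossing (P.dart d j))
    (hne : P.dart d i ≠ P.dart d j) : P.nonSeifertTurn (P.dart d i) = P.dart d j :=
  ((P.eq_or_eq_nonSeifertTurn h (P.sameDirection_dart_dart d i j)).resolve_left hne.symm).symm

theorem eq_or_eq_of_crossing_dart {d : D} {i j k : ℕ} (hi : i < P.length) (hj : j < P.length)
    (hk : k < P.length) (hij : i ≠ j) (h : P.crossing (P.dart d i) = P.crossing (P.dart d j))
    (h' : P.crossing (P.dart d k) = P.crossing (P.dart d i)) : k = i ∨ k = j := by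
  have h1 := P.nonSeifertTurn_dart h fun e => hij (P.dart_inj hi hj e)
  rcases P.eq_or_eq_nonSeifertTurn h'.symm (P.sameDirection_dart_dart d i k) with h2 | h2
  · exact Or.inl (P.dart_inj hk hi h2)
  · exact Or.inr (P.dart_inj hk hj (h2.trans h1))

theorem exists_visits (d : D) (v : P.Crossing) : ∃ i j, i < j ∧ j < P.length ∧
    P.crossing (P.dart d i) = v ∧ P.crossing (P.dart d j) = v := by
  obtain ⟨e, rfl⟩ := Quotient.exists_rep v
  obtain ⟨e', he', hd⟩ : ∃ e', P.crossing e' = P.crossing e ∧ P.SameDirection d e' := by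
    by_cases h : P.SameDirection d e
    · exact ⟨e, rfl, h⟩
    · exact ⟨P.opp e, P.crossing_opp e, (P.sameDirection_opp _ _).2 h⟩
  obtain ⟨i, hi, h1⟩ := P.exists_dart_eq hd
  obtain ⟨j, hj, h2⟩ := P.exists_dart_eq (hd.trans (P.sameDirection_nonSeifertTurn e'))
  have hc : P.crossing (P.dart d j) = P.crossing e := by rw [h2, crossing_nonSeifertTurn, he']
  have hc' : P.crossing (P.dart d i) = P.crossing e := by rw [h1, he']
  rcases lt_trichotomy i j with h | rfl | h
  · exact ⟨i, j, h, hj, hc', hc⟩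
  · exact absurd (h2.symm.trans h1) (P.nonSeifertTurn_ne e')
  · exact ⟨j, i, h, hi, hc, hc'⟩

theorem MeetsInCyclicOrder.exists_positions {w : List P.Crossing} (h : P.MeetsInCyclicOrder w) :
    ∃ d, ∃ l : List ℕ, l.Pairwise (· < ·) ∧ (∀ i ∈ l, i < P.length) ∧
      w = l.map fun i => P.crossing (P.dart d i) := by
  obtain ⟨d, h⟩ := h
  rw [gaussWord, List.sublist_map_iff] at h
  obtain ⟨l, hl, rfl⟩ := h
  exact ⟨d, l, List.Pairwise.sublist hl List.pairwise_lt_range,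
    fun i hi => List.mem_range.1 (hl.subset hi), rfl⟩

/-- The window of positions may start at any `n` and run into the next round, which provides the
cyclic rotations. -/
theorem meetsInCyclicOrder_of_positions {d : D} {l : List ℕ} (n : ℕ) (hl : l.Pairwise (· < ·))
    (h : ∀ i ∈ l, n ≤ i ∧ i < n + P.length) :
    P.MeetsInCyclicOrder (l.map fun i => P.crossing (P.dart d i)) := by
  refine ⟨P.dart d n, ?_⟩
  rw [gaussWord, List.sublist_map_iff]
  refine ⟨l.map (· - n), ?_, ?_⟩
  · have hs : (l.map (· - n)).Pairwise (· < ·) := by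
      rw [List.pairwise_map]
      refine hl.imp_of_mem ?_
      intro a b ha hb hab
      have := h a ha
      have := h b hb
      omega
    refine List.sublist_of_subperm_of_pairwise (r := (· < ·)) ?_ hs List.pairwise_lt_range
    refine List.subperm_of_subset (hs.imp ne_of_lt) ?_
    intro i hi
    obtain ⟨k, hk, rfl⟩ := List.mem_map.1 hi
    have := h k hk
    rw [List.mem_range]
    change _ < P.length
    omega
  · rw [List.map_map]
    refine List.map_congr_left fun i hi => ?_
    have := h i hi
    change _ = P.crossing (P.dart (P.dart d n) (i - n))
    rw [dart_dart, Nat.add_sub_cancel' this.1]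

end KnotProjection

/-! ### Euler's formula and cohomology mod 2 -/

namespace KnotProjection

variable {D : Type*} [Finite D] (P : KnotProjection D)

theorem card_eq_two_mul_orbitCount_edge : Nat.card D = 2 * orbitCount P.edge := by
  have h2 : ∀ a b : D, P.edge.SameCycle a b → b = a ∨ b = P.edge a := by
    rintro a b ⟨i, rfl⟩
    have hs : P.edge ^ (2 : ℤ) = 1 := by
      rw [zpow_two]; ext x; exact P.edge_edge x
    obtain ⟨j, rfl | rfl⟩ := Int.even_or_odd' i
    · left; rw [zpow_mul, hs, one_zpow]; rfl
    · right; rw [zpow_add, zpow_mul, hs, one_zpow, one_mul, zpow_one]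
  let f : Quotient (Perm.SameCycle.setoid P.edge) × Bool → D :=
    fun p => if p.2 then p.1.out else P.edge p.1.out
  have hq : ∀ p, Quotient.mk (Perm.SameCycle.setoid P.edge) (f p) = p.1 := by
    rintro ⟨q, b⟩
    cases b
    · refine (Quotient.sound ?_).trans q.out_eq
      exact Perm.sameCycle_apply_left.2 (Perm.SameCycle.refl _ _)
    · exact q.out_eq
  have hf : Function.Bijective f := by
    constructor
    · intro p p' h
      have h1 : p.1 = p'.1 := by rw [← hq p, ← hq p', h]
      obtain ⟨q, b⟩ := p
      obtain ⟨q', b'⟩ := p'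
      obtain rfl : q = q' := h1
      have := P.edge_ne q.out
      cases b <;> cases b' <;> simp only [f, if_true, Bool.false_eq_true, if_false] at h
      · rfl
      · exact absurd h this
      · exact absurd h.symm this
      · rfl
    · intro d
      have hd : P.edge.SameCycle (Quotient.mk (Perm.SameCycle.setoid P.edge) d).out d :=
        Quotient.mk_out (s := Perm.SameCycle.setoid P.edge) d
      rcases h2 _ _ hd with h | h
      · exact ⟨(_, true), h.symm⟩
      · exact ⟨(_, false), h.symm⟩
  have := Nat.card_congr (Equiv.ofBijective f hf)
  rw [Nat.card_prod] at this
  rw [← this, orbitCount]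
  simp [mul_comm]

open Classical in
/-- The first cohomology of the sphere with coefficients in `ZMod 2` vanishes: if the number of
marked corners (the support of `χ`) is even at each double point and in each face, then the arms can
be given two sides that change from `d` to `rot d` exactly at the marked corners, and do not
change along the edges. -/
theorem exists_side [Fintype D] (χ : D → ZMod 2)
    (hv : ∀ v : P.Crossing, (∑ d, if P.crossing d = v then χ d else 0) = 0)
    (hf : ∀ F : P.Face, (∑ d, if P.face d = F then χ d else 0) = 0) :
    ∃ s : D → ZMod 2, (∀ d, s (P.edge d) = s d) ∧ ∀ d, s d + s (P.rot d) = χ d := by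
  obtain ⟨d₀⟩ := P.nonempty
  let V := P.Crossing
  let F := P.Face
  let E := Quotient (Perm.SameCycle.setoid P.edge)
  have : Fintype V := Fintype.ofFinite (Quotient _)
  have : Fintype F := Fintype.ofFinite (Quotient _)
  have : Fintype E := Fintype.ofFinite (Quotient _)
  have hχ0 : ∀ a b : ZMod 2, a + b = 0 ↔ a = b := by decide
  let e : D → E := Quotient.mk _
  have he : ∀ d, e (P.edge d) = e d := fun d =>
    Quotient.sound (Perm.sameCycle_apply_left.2 (Perm.SameCycle.refl _ _))
  have hconst : ∀ g : D → ZMod 2, (∀ d, g (P.edge d) = g d) → (∀ d, g (P.rot d) = g d) →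
      ∀ d, g d = g d₀ := by
    intro g h1 h2 d
    refine eq_of_eqvGen ?_ (P.one_component d d₀)
    rintro a b (rfl | rfl)
    · exact (h1 a).symm
    · rw [h2, h2]
  -- The coboundary from edges to corners; the rows of `M` below are the double points and the
  -- faces, so `ker M` consists of the even markings.
  let δ : (E → ZMod 2) →ₗ[ZMod 2] (D → ZMod 2) :=
    { toFun := fun s d => s (e d) + s (e (P.rot d))
      map_add' := by intro s t; ext d; simp only [Pi.add_apply]; ring
      map_smul' := by intro c s; ext d; simp [mul_add] }
  let M : Matrix (V ⊕ F) D (ZMod 2) := fun x d =>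
    Sum.elim (fun v => if P.crossing d = v then 1 else 0) (fun f => if P.face d = f then 1 else 0) x
  have hMv : ∀ (x : D → ZMod 2) (v : V), (M.mulVec x) (Sum.inl v) =
      ∑ d, if P.crossing d = v then x d else 0 := by
    intro x v; simp [Matrix.mulVec, dotProduct, M]
  have hMf : ∀ (x : D → ZMod 2) (f : F), (M.mulVec x) (Sum.inr f) =
      ∑ d, if P.face d = f then x d else 0 := by
    intro x f; simp [Matrix.mulVec, dotProduct, M]
  have hMt : ∀ (γ : V ⊕ F → ZMod 2) (d : D), (M.transpose.mulVec γ) d =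
      γ (Sum.inl (P.crossing d)) + γ (Sum.inr (P.face d)) := by
    intro γ d
    simp only [Matrix.mulVec, dotProduct, Matrix.transpose_apply, Fintype.sum_sum_type]
    simp [M]
  have hle : LinearMap.range δ ≤ LinearMap.ker M.mulVecLin := by
    rintro _ ⟨s, rfl⟩
    rw [LinearMap.mem_ker, Matrix.mulVecLin_apply]
    ext x
    rcases x with v | f
    · rw [hMv, Pi.zero_apply]
      have h1 : ∀ d, (if P.crossing d = v then δ s d else 0) =
          (if P.crossing d = v then s (e d) else 0) +
          (if P.crossing (P.rot d) = v then s (e (P.rot d)) else 0) := by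
        intro d; rw [P.crossing_rot]; split_ifs <;> simp [δ]
      rw [Finset.sum_congr rfl fun d _ => h1 d, Finset.sum_add_distrib,
        Equiv.sum_comp P.rot fun d => if P.crossing d = v then s (e d) else 0]
      exact CharTwo.add_self_eq_zero _
    · rw [hMf, Pi.zero_apply]
      have h1 : ∀ d, (if P.face d = f then δ s d else 0) =
          (if P.face (P.faceNext d) = f then s (e (P.rot (P.faceNext d))) else 0) +
          (if P.face d = f then s (e (P.rot d)) else 0) := by
        intro d
        have : P.rot (P.faceNext d) = P.edge d := by simp [faceNext]
        rw [P.face_faceNext, this, he]; split_ifs <;> simp [δ]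
      rw [Finset.sum_congr rfl fun d _ => h1 d, Finset.sum_add_distrib,
        Equiv.sum_comp P.faceNext fun d => if P.face d = f then s (e (P.rot d)) else 0]
      exact CharTwo.add_self_eq_zero _
  have hkerδ : Module.finrank (ZMod 2) (LinearMap.ker δ) ≤ 1 := by
    let ev : LinearMap.ker δ →ₗ[ZMod 2] ZMod 2 :=
      (LinearMap.proj (e d₀)).comp (LinearMap.ker δ).subtype
    have hinj : Function.Injective ev := by
      rw [← LinearMap.ker_eq_bot, LinearMap.ker_eq_bot']
      rintro ⟨s, hs⟩ h0
      have h0' : s (e d₀) = 0 := h0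
      have h1 : ∀ d, s (e d) = s (e (P.rot d)) := fun d =>
        (hχ0 _ _).1 (congrFun (LinearMap.mem_ker.1 hs) d)
      ext q
      obtain ⟨d, rfl⟩ := Quotient.exists_rep q
      change s (e d) = 0
      rw [hconst (fun d => s (e d)) (fun d => by simp only [he]) (fun d => (h1 d).symm) d, h0']
    simpa using LinearMap.finrank_le_finrank_of_injective hinj
  have hkerM : Module.finrank (ZMod 2) (LinearMap.ker M.transpose.mulVecLin) ≤ 1 := by
    let ev : LinearMap.ker M.transpose.mulVecLin →ₗ[ZMod 2] ZMod 2 :=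
      (LinearMap.proj (Sum.inl (P.crossing d₀))).comp (LinearMap.ker M.transpose.mulVecLin).subtype
    have hinj : Function.Injective ev := by
      rw [← LinearMap.ker_eq_bot, LinearMap.ker_eq_bot']
      rintro ⟨γ, hγ⟩ h0
      have h0' : γ (Sum.inl (P.crossing d₀)) = 0 := h0
      have h1 : ∀ d, γ (Sum.inl (P.crossing d)) = γ (Sum.inr (P.face d)) := by
        intro d
        have := congrFun (LinearMap.mem_ker.1 hγ) d
        rw [← hχ0]
        exact (hMt γ d).symm.trans this
      have h2 : ∀ d, γ (Sum.inl (P.crossing d)) = 0 := by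
        intro d
        rw [hconst (fun d => γ (Sum.inl (P.crossing d))) ?_ (fun d => by simp only [P.crossing_rot]) d,
          h0']
        intro d
        have : P.edge d = P.rot (P.faceNext d) := by simp [faceNext]
        rw [this, P.crossing_rot, h1, P.face_faceNext, h1]
      ext x
      rcases x with q | q
      · obtain ⟨d, rfl⟩ := Quotient.exists_rep q
        exact h2 d
      · obtain ⟨d, rfl⟩ := Quotient.exists_rep q
        exact (h1 d).symm.trans (h2 d)
    simpa using LinearMap.finrank_le_finrank_of_injective hinj
  have e1 := LinearMap.finrank_range_add_finrank_ker δ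
  have e2 := LinearMap.finrank_range_add_finrank_ker M.mulVecLin
  have e3 := LinearMap.finrank_range_add_finrank_ker M.transpose.mulVecLin
  have e4 : M.transpose.rank = M.rank := M.rank_transpose
  unfold Matrix.rank at e4
  have hcard := P.card_eq_two_mul_orbitCount_edge
  have hEuler := P.spherical
  have hVc : orbitCount P.rot = Fintype.card V := Nat.card_eq_fintype_card (α := V)
  have hFc : orbitCount (P.rot⁻¹ * P.edge) = Fintype.card F := Nat.card_eq_fintype_card (α := F)
  have hEc : orbitCount P.edge = Fintype.card E := Nat.card_eq_fintype_card (α := E)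
  rw [Nat.card_eq_fintype_card] at hcard
  simp only [Module.finrank_fintype_fun_eq_card, Fintype.card_sum] at e1 e2 e3
  -- Connectedness bounds both kernels by dimension 1. So `range δ` has dimension at least `E - 1`,
  -- while `ker M` has dimension at most `2E - (V + F - 1) = E - 1` by Euler's formula.
  have heq := Submodule.eq_of_le_of_finrank_le hle (by omega)
  have hmem : χ ∈ LinearMap.ker M.mulVecLin := by
    rw [LinearMap.mem_ker, Matrix.mulVecLin_apply]
    ext x
    rcases x with v | f
    · rw [hMv, Pi.zero_apply]
      exact hv v
    · rw [hMf, Pi.zero_apply]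
      exact hf f
  rw [← heq] at hmem
  obtain ⟨s, hs⟩ := hmem
  exact ⟨fun d => s (e d), fun d => by simp only [he], fun d => congrFun hs d⟩

end KnotProjection

/-! ### The two sides of a circle -/

namespace KnotProjection

variable {D : Type*} [Finite D] (P : KnotProjection D)

/-- `s` tells on which side of the circle described by `c` an arm lies. -/
structure IsSide {k : ℕ} (c : Fin k → D) (s : D → ZMod 2) : Prop where
  edge : ∀ d, s (P.edge d) = s d
  opp_of_ne : ∀ d, (∀ i, P.crossing (c i) ≠ P.crossing d) → s (P.opp d) = s d
  opp_of_eq : ∀ i d, P.crossing (c i) = P.crossing d → s (P.opp d) = s d + 1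
  rot_corner : ∀ i, s (P.rot (c i)) = s (c i) + 1

variable {P}

/-- A circle has two sides. -/
theorem IsCircleThrough.exists_isSide {k : ℕ} [NeZero k] {c : Fin k → D}
    (hc : P.IsCircleThrough c) : ∃ s, P.IsSide c s := by
  classical
  cases nonempty_fintype D
  -- The marked corners are those through which the circle passes, two at each of its points. In
  -- each face, corners of departure match corners of arrival by the shift of the index.
  let χ : D → ZMod 2 := fun d =>
    ∑ i, ((if d = c i then 1 else 0) + (if d = P.opp (c i) then 1 else 0))
  have hsum : ∀ p : D → Prop, (∑ d, if p d then χ d else 0) =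
      (∑ i, if p (c i) then (1 : ZMod 2) else 0) + ∑ i, if p (P.opp (c i)) then 1 else 0 := by
    intro p
    have h : ∀ d, (if p d then χ d else 0) =
        ∑ i, ((if d = c i then (if p d then 1 else 0) else 0) +
          (if d = P.opp (c i) then (if p d then 1 else 0) else 0)) := by
      intro d
      by_cases hp : p d <;> simp [hp, χ]
    rw [Finset.sum_congr rfl fun d _ => h d, Finset.sum_comm, ← Finset.sum_add_distrib]
    refine Finset.sum_congr rfl fun i _ => ?_
    rw [Finset.sum_add_distrib]
    simp
  obtain ⟨s, hs, hχ⟩ := P.exists_side χ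
    (fun v => by
      rw [hsum fun d => P.crossing d = v]
      simp only [crossing_opp]
      exact CharTwo.add_self_eq_zero _)
    (fun F => by
      rw [hsum fun d => P.face d = F]
      simp only [hc.2.2]
      have h := Equiv.sum_comp (Equiv.addRight (1 : Fin k)) fun i =>
        if P.face (P.opp (c i)) = F then (1 : ZMod 2) else 0
      simp only [Equiv.coe_addRight] at h
      refine (congrArg₂ (· + ·) (Eq.trans ?_ h) rfl).trans (CharTwo.add_self_eq_zero _)
      exact Finset.sum_congr rfl fun i _ => by congr)
  have hadd : ∀ a b x : ZMod 2, a + b = x → b = a + x := by decide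
  have hrot : ∀ d, s (P.rot d) = s d + χ d := fun d => hadd _ _ _ (hχ d)
  have hopp : ∀ d, s (P.opp d) = s d + χ d + χ (P.rot d) := fun d => by
    rw [← hrot, ← hrot]; rfl
  have hχ0 : ∀ d, (∀ i, P.crossing (c i) ≠ P.crossing d) → χ d = 0 := by
    intro d hd
    refine Finset.sum_eq_zero fun i _ => ?_
    rw [if_neg, if_neg, add_zero]
    · rintro rfl; exact hd i (P.crossing_opp _).symm
    · rintro rfl; exact hd i rfl
  have hχ1 : ∀ i d, P.crossing (c i) = P.crossing d → χ d =
      (if d = c i then 1 else 0) + (if d = P.opp (c i) then 1 else 0) := by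
    intro i d hd
    refine Finset.sum_eq_single i (fun j _ hj => ?_) (by simp)
    have hj' : P.crossing (c j) ≠ P.crossing d := fun h => hj (hc.1 (h.trans hd.symm))
    rw [if_neg, if_neg, add_zero]
    · rintro rfl; exact hj' (P.crossing_opp _).symm
    · rintro rfl; exact hj' rfl
  have hinj : ∀ a b, P.opp a = P.opp b ↔ a = b := fun a b =>
    ⟨fun h => by rw [← P.opp_opp a, h, P.opp_opp], fun h => by rw [h]⟩
  have hne1 := P.rot_ne
  have hne2 := P.opp_ne
  have hne3 : ∀ d, P.rot d ≠ P.opp d := fun d h => P.rot_ne _ (P.rot.injective h).symm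
  have hcorner : ∀ i, χ (c i) = 1 := fun i => by
    rw [hχ1 i _ rfl, if_pos rfl, if_neg (hne2 _).symm, add_zero]
  have hcorner' : ∀ i, χ (P.rot (c i)) = 0 := fun i => by
    rw [hχ1 i _ (P.crossing_rot _).symm, if_neg (hne1 _), if_neg (hne3 _), add_zero]
  have hχopp : ∀ i d, P.crossing (c i) = P.crossing d → χ (P.opp d) = χ d := by
    intro i d hd
    rw [hχ1 i d hd, hχ1 i _ (hd.trans (P.crossing_opp d).symm), hinj, add_comm]
    congr 1
    rw [← hinj d (P.opp (c i)), P.opp_opp]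
  refine ⟨s, hs, ?_, ?_, fun i => by rw [hrot, hcorner]⟩
  · intro d hd
    rw [hopp, hχ0 d hd, hχ0 _ (by simpa [P.crossing_rot] using hd), add_zero, add_zero]
  · intro i d hd
    have h2 : ∀ x : ZMod 2, x + 0 + 1 = x + 1 ∧ x + 1 + 0 = x + 1 := by decide
    rw [hopp]
    -- Of the two neighbouring corners between `d` and `opp d`, exactly one is marked.
    rcases (P.crossing_eq_iff _ _).1 hd with rfl | rfl | rfl | rfl
    · rw [hcorner, hcorner']; simp
    · rw [hcorner', rot_rot, hχopp i _ rfl, hcorner]; simp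
    · rw [hχopp i _ rfl, rot_opp, hχopp i _ (P.crossing_rot _).symm, hcorner, hcorner']; simp
    · rw [hχopp i _ (P.crossing_rot _).symm, rot_opp, rot_rot, P.opp_opp, hcorner, hcorner']; simp

variable {k : ℕ} {c : Fin k → D} {s : D → ZMod 2}

/-- The circle has the two outgoing arms on one side exactly if it passes between differently
directed arms. -/
theorem IsSide.nonSeifertTurn_iff (hs : P.IsSide c s) {i : Fin k} {d : D}
    (hd : P.crossing (c i) = P.crossing d) :
    s (P.nonSeifertTurn d) = s d ↔ ¬ P.SameDirection (c i) (P.rot (c i)) := by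
  have h1 : ∀ x : ZMod 2, x + 1 ≠ x ∧ x ≠ x + 1 ∧ x + 1 + 1 = x := by decide
  have hinj : ∀ a b : ZMod 2, a + 1 = b + 1 ↔ a = b := by decide
  have hopp : ∀ d, P.crossing (c i) = P.crossing d →
      ((s (P.nonSeifertTurn (P.opp d)) = s (P.opp d)) ↔ s (P.nonSeifertTurn d) = s d) := by
    intro d hd
    rw [nonSeifertTurn_opp, hs.opp_of_eq i _ hd,
      hs.opp_of_eq i _ (hd.trans (P.crossing_nonSeifertTurn d).symm), hinj]
  have hr := hs.rot_corner i
  have ho := hs.opp_of_eq i _ rfl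
  have hor := hs.opp_of_eq i _ (P.crossing_rot (c i)).symm
  have hc0 : s (P.nonSeifertTurn (c i)) = s (c i) ↔ ¬ P.SameDirection (c i) (P.rot (c i)) := by
    unfold nonSeifertTurn
    split_ifs with h
    · simp [h, hr]
    · simp [h, rot_inv, hor, hr, h1]
  have hc1 : s (P.nonSeifertTurn (P.rot (c i))) = s (P.rot (c i)) ↔
      ¬ P.SameDirection (c i) (P.rot (c i)) := by
    have : P.SameDirection (P.rot (c i)) (P.rot (P.rot (c i))) ↔
        ¬ P.SameDirection (c i) (P.rot (c i)) := by
      rw [rot_rot, sameDirection_opp]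
      exact not_congr ⟨fun h => h.symm, fun h => h.symm⟩
    unfold nonSeifertTurn
    split_ifs with h
    · simp [this.1 h, rot_rot, ho, hr]
    · simp [not_not.1 (mt this.2 h), hr]
  rcases (P.crossing_eq_iff _ _).1 hd with rfl | rfl | rfl | rfl
  · exact hc0
  · exact hc1
  · rw [hopp _ rfl, hc0]
  · rw [hopp _ (P.crossing_rot _).symm, hc1]

open Classical in
-- The side is constant along an edge, so only the straight passage through the next double point
-- can change it.
theorem IsSide.dart_succ (hs : P.IsSide c s) (d : D) (n : ℕ) :
    s (P.dart d (n + 1)) =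
      s (P.dart d n) + if ∃ i, P.crossing (c i) = P.crossing (P.dart d (n + 1)) then 1 else 0 := by
  have h2 : ∀ a b : ZMod 2, a = b + 1 → b = a + 1 := by decide
  have h := hs.edge (P.dart d n)
  rw [← opp_dart_succ] at h
  split_ifs with hi
  · obtain ⟨i, hi⟩ := hi
    rw [hs.opp_of_eq i _ hi] at h
    exact h2 _ _ h.symm
  · push Not at hi
    rw [hs.opp_of_ne _ hi] at h
    rw [h, add_zero]

/-- The curve changes the side at each visit to a double point of the circle, and nowhere else. -/
theorem IsSide.dart_eq (hs : P.IsSide c s) {d : D} {T : Finset ℕ}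
    (hT : ∀ n, 0 < n → n < P.length → ((∃ i, P.crossing (c i) = P.crossing (P.dart d n)) ↔ n ∈ T))
    (h0 : 0 ∉ T) (n : ℕ) (hn : n < P.length) :
    s (P.dart d n) = s d + ((∑ t ∈ T, if t ≤ n then 1 else 0 : ℕ) : ZMod 2) := by
  induction n with
  | zero =>
    rw [Finset.sum_eq_zero, dart_zero, Nat.cast_zero, add_zero]
    intro t ht
    rw [if_neg]
    intro h
    exact h0 (by rwa [← Nat.le_zero.1 h])
  | succ n ih =>
    have h : ∀ t, (if t ≤ n + 1 then 1 else 0 : ℕ) =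
        (if t ≤ n then 1 else 0) + if t = n + 1 then 1 else 0 := by
      intro t; split_ifs <;> omega
    rw [hs.dart_succ, ih (by omega), Finset.sum_congr rfl fun t _ => h t, Finset.sum_add_distrib,
      Finset.sum_ite_eq', Nat.cast_add, add_assoc]
    congr 2
    simp only [hT (n + 1) (by omega) hn]
    split_ifs <;> simp

theorem IsSide.dart_eq_of_forall (hs : P.IsSide c s) {d : D} {i j : ℕ} (hij : i < j)
    (hj : ∃ l, P.crossing (c l) = P.crossing (P.dart d j))
    (h : ∀ n, i < n → n < j → ∀ l, P.crossing (c l) ≠ P.crossing (P.dart d n)) :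
    s (P.dart d j) = s (P.dart d i) + 1 := by
  obtain ⟨m, rfl⟩ : ∃ m, j = m + 1 := ⟨j - 1, by omega⟩
  have : ∀ n, i ≤ n → n ≤ m → s (P.dart d n) = s (P.dart d i) := by
    intro n hin
    induction n, hin using Nat.le_induction with
    | base => intro _; rfl
    | succ n hin ih =>
      intro hnm
      rw [hs.dart_succ, if_neg, add_zero, ih (by omega)]
      rintro ⟨l, hl⟩
      exact h (n + 1) (by omega) (by omega) l hl
  rw [hs.dart_succ, if_pos hj, this m (by omega) le_rfl]

theorem IsSide.dart_eq_iff (hs : P.IsSide c s) {l : Fin k} {d : D} {i j : ℕ}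
    (hi : P.crossing (c l) = P.crossing (P.dart d i))
    (hj : P.crossing (c l) = P.crossing (P.dart d j)) (hne : P.dart d i ≠ P.dart d j) :
    s (P.dart d j) = s (P.dart d i) ↔ ¬ P.SameDirection (c l) (P.rot (c l)) := by
  rw [← hs.nonSeifertTurn_iff hi, P.nonSeifertTurn_dart (hi.symm.trans hj) hne]

/-! ### Circles and the order of visits -/

variable (P) in
theorem exists_second_visit (d : D) : ∃ p, 0 < p ∧ p < P.length ∧
    P.crossing (P.dart d p) = P.crossing d ∧
    ∀ n < P.length, P.crossing (P.dart d n) = P.crossing d ↔ n = 0 ∨ n = p := by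
  obtain ⟨i, j, hij, hj, h1, h2⟩ := P.exists_visits d (P.crossing d)
  have h := P.eq_or_eq_of_crossing_dart (d := d) (k := 0) (hij.trans hj) hj P.length_pos hij.ne
    (h1.trans h2.symm) h1.symm
  have hi : i = 0 := by omega
  subst hi
  refine ⟨j, hij, hj, h2, fun n hn => ⟨fun h => ?_, ?_⟩⟩
  · exact P.eq_or_eq_of_crossing_dart (hij.trans hj) hj hn hij.ne (h1.trans h2.symm)
      (h.trans h1.symm)
  · rintro (rfl | rfl)
    · rfl
    · exact h2

variable (P) in
theorem exists_two_visits (d : D) (v : P.Crossing) (hv : v ≠ P.crossing d) : ∃ q r, 0 < q ∧ q < r ∧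
    r < P.length ∧ P.crossing (P.dart d q) = v ∧ P.crossing (P.dart d r) = v ∧
    ∀ n < P.length, P.crossing (P.dart d n) = v ↔ n = q ∨ n = r := by
  obtain ⟨i, j, hij, hj, h1, h2⟩ := P.exists_visits d v
  refine ⟨i, j, ?_, hij, hj, h1, h2, fun n hn => ⟨fun h => ?_, ?_⟩⟩
  · rcases Nat.eq_zero_or_pos i with rfl | h
    · exact absurd h1.symm hv
    · exact h
  · exact P.eq_or_eq_of_crossing_dart (hij.trans hj) hj hn hij.ne (h1.trans h2.symm)
      (h.trans h1.symm)
  · rintro (rfl | rfl)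
    · exact h1
    · exact h2

/-- The outgoing arms at `c 0` lie on one side, so the side changes an even number of times from one
to the other. One change is the second visit itself; hence exactly one visit to the other point lies
in between. -/
theorem IsCircleThrough.meets_of_two {c : Fin 2 → D} (hc : P.IsCircleThrough c)
    (h : ¬ P.SameDirection (c 0) (P.rot (c 0))) :
    P.MeetsInCyclicOrder [P.crossing (c 0), P.crossing (c 1), P.crossing (c 0),
      P.crossing (c 1)] := by
  obtain ⟨s, hs⟩ := hc.exists_isSide
  have hne : P.crossing (c 1) ≠ P.crossing (c 0) := fun h => by simpa using hc.1 h
  obtain ⟨p, hp0, hpN, hp, hpu⟩ := P.exists_second_visit (c 0)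
  obtain ⟨q, r, hq0, hqr, hrN, hq, hr, hqu⟩ := P.exists_two_visits (c 0) _ hne
  have hpq : p ≠ q := by rintro rfl; exact hne (hq.symm.trans hp)
  have hpr : p ≠ r := by rintro rfl; exact hne (hr.symm.trans hp)
  have hT : ∀ n, 0 < n → n < P.length →
      ((∃ i, P.crossing (c i) = P.crossing (P.dart (c 0) n)) ↔ n ∈ ({p, q, r} : Finset ℕ)) := by
    intro n hn0 hn
    rw [Fin.exists_fin_two, @eq_comm _ (P.crossing (c 0)), hpu n hn, @eq_comm _ (P.crossing (c 1)),
      hqu n hn]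
    simp only [Finset.mem_insert, Finset.mem_singleton]
    omega
  have h1 := hs.dart_eq hT (by simp; omega) p hpN
  have h2 := (hs.dart_eq_iff (l := 0) (d := c 0) (i := 0) (j := p) rfl hp.symm
    (fun e => hp0.ne (P.dart_inj P.length_pos hpN e))).2 h
  rw [dart_zero] at h2
  rw [h2, left_eq_add, ZMod.natCast_eq_zero_iff, Finset.sum_insert (by simp; omega),
    Finset.sum_insert (by simp; omega), Finset.sum_singleton, if_pos le_rfl] at h1
  have h3 : q < p ∧ p < r := by
    split_ifs at h1 <;> omega
  have := P.meetsInCyclicOrder_of_positions (d := c 0) (l := [0, q, p, r]) 0 (by simp; omega)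
    (by simp; omega)
  simpa [hq, hp, hr, dart_zero] using this

/-- By parity each of the points 1 and 2 is interlaced with an odd number of the other two points.
As they are not interlaced with each other, both are interlaced with point 0. -/
theorem IsCircleThrough.meets_of_three {c : Fin 3 → D} (hc : P.IsCircleThrough c)
    (h1 : ¬ P.SameDirection (c 1) (P.rot (c 1))) (h2 : ¬ P.SameDirection (c 2) (P.rot (c 2)))
    (hn : ¬ P.MeetsInCyclicOrder [P.crossing (c 1), P.crossing (c 2), P.crossing (c 1),
      P.crossing (c 2)]) :
    P.MeetsInCyclicOrder [P.crossing (c 0), P.crossing (c 1), P.crossing (c 2),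
      P.crossing (c 0), P.crossing (c 2), P.crossing (c 1)] := by
  obtain ⟨s, hs⟩ := hc.exists_isSide
  have hne0 : P.crossing (c 0) ≠ P.crossing (c 1) := fun h => by simpa using hc.1 h
  have hne2 : P.crossing (c 2) ≠ P.crossing (c 1) := fun h => by simpa using hc.1 h
  have hne : P.crossing (c 0) ≠ P.crossing (c 2) := fun h => by simpa using hc.1 h
  obtain ⟨p, hp0, hpN, hp, hpu⟩ := P.exists_second_visit (c 1)
  obtain ⟨q, r, hq0, hqr, hrN, hq, hr, hqu⟩ := P.exists_two_visits (c 1) _ hne2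
  obtain ⟨u, v, hu0, huv, hvN, hu, hv, huu⟩ := P.exists_two_visits (c 1) _ hne0
  have hpq : p ≠ q := by rintro rfl; exact hne2 (hq.symm.trans hp)
  have hpr : p ≠ r := by rintro rfl; exact hne2 (hr.symm.trans hp)
  have hpu' : p ≠ u := by rintro rfl; exact hne0 (hu.symm.trans hp)
  have hpv : p ≠ v := by rintro rfl; exact hne0 (hv.symm.trans hp)
  have hqu' : q ≠ u := by rintro rfl; exact hne (hu.symm.trans hq)
  have hqv : q ≠ v := by rintro rfl; exact hne (hv.symm.trans hq)
  have hru : r ≠ u := by rintro rfl; exact hne (hu.symm.trans hr)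
  have hrv : r ≠ v := by rintro rfl; exact hne (hv.symm.trans hr)
  have hT : ∀ n, 0 < n → n < P.length →
      ((∃ i, P.crossing (c i) = P.crossing (P.dart (c 1) n)) ↔
        n ∈ ({p, q, r, u, v} : Finset ℕ)) := by
    intro n hn0 hn
    rw [Fin.exists_fin_succ, Fin.exists_fin_two]
    change (P.crossing (c 0) = _ ∨ P.crossing (c 1) = _ ∨ P.crossing (c 2) = _) ↔ _
    rw [@eq_comm _ (P.crossing (c 0)), huu n hn, @eq_comm _ (P.crossing (c 1)), hpu n hn,
      @eq_comm _ (P.crossing (c 2)), hqu n hn]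
    simp only [Finset.mem_insert, Finset.mem_singleton]
    omega
  have hd := hs.dart_eq hT (by simp; omega)
  have hsp := (hs.dart_eq_iff (l := 1) (d := c 1) (i := 0) (j := p) rfl hp.symm
    (fun e => hp0.ne (P.dart_inj P.length_pos hpN e))).2 h1
  have hsq := (hs.dart_eq_iff (l := 2) (d := c 1) (i := q) (j := r) hq.symm hr.symm
    (fun e => hqr.ne (P.dart_inj (by omega) hrN e))).2 h2
  have hsum : ∀ n, (∑ t ∈ ({p, q, r, u, v} : Finset ℕ), if t ≤ n then 1 else 0) =
      (if p ≤ n then 1 else 0) + ((if q ≤ n then 1 else 0) + ((if r ≤ n then 1 else 0) +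
        ((if u ≤ n then 1 else 0) + if v ≤ n then 1 else 0))) := by
    intro n
    rw [Finset.sum_insert (by simp; omega), Finset.sum_insert (by simp; omega),
      Finset.sum_insert (by simp; omega), Finset.sum_insert (by simp; omega), Finset.sum_singleton]
  rw [dart_zero, hd p hpN, add_eq_left, ZMod.natCast_eq_zero_iff, hsum] at hsp
  rw [hd q (by omega), hd r hrN, add_right_inj, ZMod.natCast_eq_natCast_iff', hsum, hsum] at hsq
  have hn' : ¬ (q < p ∧ p < r) := by
    intro h
    apply hn
    have := P.meetsInCyclicOrder_of_positions (d := c 1) (l := [0, q, p, r]) 0 (by simp; omega)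
      (by simp; omega)
    simpa [hq, hp, hr, dart_zero] using this
  -- Point 1 is visited at `0` and `p`, point 2 at `q` and `r`, point 0 at `u` and `v`. The cases
  -- are whether point 2 is visited after or before time `p`.
  have key : (u < p ∧ p < q ∧ q < v ∧ v < r) ∨ (q < u ∧ u < r ∧ r < p ∧ p < v) := by
    have hb : ∀ x y : ℕ, x ≠ y → ((if x ≤ y then 1 else 0 : ℕ) = 1 ∧ x < y) ∨
        ((if x ≤ y then 1 else 0 : ℕ) = 0 ∧ y < x) := by
      intro x y h; split_ifs <;> omega
    simp only [le_refl, if_true, if_pos hqr.le, if_neg hqr.not_ge] at hsp hsq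
    rcases lt_or_gt_of_ne hpq with h | h
    · have hpr' : p < r := by omega
      have a1 := hb u p hpu'.symm
      have a2 := hb v p hpv.symm
      have a3 := hb u q hqu'.symm
      have a4 := hb v q hqv.symm
      have a5 := hb u r hru.symm
      have a6 := hb v r hrv.symm
      simp only [if_pos h.le, if_pos hpr'.le, if_neg h.not_ge, if_neg hpr'.not_ge] at hsp hsq
      omega
    · have hpr' : r < p := by omega
      have a1 := hb u p hpu'.symm
      have a2 := hb v p hpv.symm
      have a3 := hb u q hqu'.symm
      have a4 := hb v q hqv.symm
      have a5 := hb u r hru.symm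
      have a6 := hb v r hrv.symm
      simp only [if_pos h.le, if_pos hpr'.le, if_neg h.not_ge, if_neg hpr'.not_ge] at hsp hsq
      omega
  have hN : P.crossing (P.dart (c 1) P.length) = P.crossing (c 1) := by rw [dart_length]
  have hadd : ∀ n, P.dart (c 1) (P.length + n) = P.dart (c 1) n := fun n => by
    rw [add_comm, dart_add_length]
  -- Both orders become the required word after rotation to a visit of point 0.
  rcases key with h | h
  · have := P.meetsInCyclicOrder_of_positions (d := c 1) (l := [u, p, q, v, r, P.length]) u
      (by simp; omega) (by simp; omega)
    simpa [hq, hp, hr, hu, hv, hN] using this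
  · have := P.meetsInCyclicOrder_of_positions (d := c 1)
      (l := [v, P.length, P.length + q, P.length + u, P.length + r, P.length + p]) v
      (by simp; omega) (by simp; omega)
    simpa [hq, hp, hr, hu, hv, hN, hadd] using this

theorem MeetsInCyclicOrder.four {a b a' b' : P.Crossing} (h : P.MeetsInCyclicOrder [a, b, a', b']) :
    ∃ d i j k l, i < j ∧ j < k ∧ k < l ∧ l < P.length ∧ P.crossing (P.dart d i) = a ∧
      P.crossing (P.dart d j) = b ∧ P.crossing (P.dart d k) = a' ∧ P.crossing (P.dart d l) = b' := by
  obtain ⟨d, w, hw, hN, he⟩ := h.exists_positions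
  rcases w with _ | ⟨i, _ | ⟨j, _ | ⟨k, _ | ⟨l, _ | ⟨_, _⟩⟩⟩⟩⟩ <;> simp at he
  simp at hw hN
  exact ⟨d, i, j, k, l, by omega, by omega, by omega, by omega, he.1.symm, he.2.1.symm,
    he.2.2.1.symm, he.2.2.2.symm⟩

theorem MeetsInCyclicOrder.six {a b c a' b' c' : P.Crossing}
    (h : P.MeetsInCyclicOrder [a, b, c, a', b', c']) :
    ∃ d i j k l m n, i < j ∧ j < k ∧ k < l ∧ l < m ∧ m < n ∧ n < P.length ∧
      P.crossing (P.dart d i) = a ∧ P.crossing (P.dart d j) = b ∧ P.crossing (P.dart d k) = c ∧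
      P.crossing (P.dart d l) = a' ∧ P.crossing (P.dart d m) = b' ∧
      P.crossing (P.dart d n) = c' := by
  obtain ⟨d, w, hw, hN, he⟩ := h.exists_positions
  rcases w with _ | ⟨i, _ | ⟨j, _ | ⟨k, _ | ⟨l, _ | ⟨m, _ | ⟨n, _ | ⟨_, _⟩⟩⟩⟩⟩⟩⟩ <;> simp at he
  simp at hw hN
  exact ⟨d, i, j, k, l, m, n, by omega, by omega, by omega, by omega, by omega, by omega,
    he.1.symm, he.2.1.symm, he.2.2.1.symm, he.2.2.2.1.symm, he.2.2.2.2.1.symm,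
    he.2.2.2.2.2.symm⟩

/-- Two changes of side separate the departures from `a`, so both outgoing arms there lie on one
side. -/
theorem IsCircleThrough.not_sameDirection_of_meets_two {c : Fin 2 → D} (hc : P.IsCircleThrough c)
    {a b : P.Crossing} (hab : ({a, b} : Set P.Crossing) = Set.range fun i => P.crossing (c i))
    (h : P.MeetsInCyclicOrder [a, b, a, b]) {l : Fin 2} (hl : P.crossing (c l) = a) :
    ¬ P.SameDirection (c l) (P.rot (c l)) := by
  obtain ⟨s, hs⟩ := hc.exists_isSide
  obtain ⟨d, i₁, i₂, i₃, i₄, h12, h23, h34, hN, e1, e2, e3, e4⟩ := h.four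
  have ha := fun n hn => P.eq_or_eq_of_crossing_dart (d := d) (i := i₁) (j := i₃) (k := n)
    (by omega) (by omega) hn (by omega) (e1.trans e3.symm)
  have hb := fun n hn => P.eq_or_eq_of_crossing_dart (d := d) (i := i₂) (j := i₄) (k := n)
    (by omega) (by omega) hn (by omega) (e2.trans e4.symm)
  have hr : ∀ i, P.crossing (c i) = a ∨ P.crossing (c i) = b := fun i =>
    hab.symm.subset ⟨i, rfl⟩
  have hv : ∀ v ∈ ({a, b} : Set P.Crossing), ∃ l, P.crossing (c l) = v := fun v hv => hab.subset hv
  have hno : ∀ n < P.length, n ≠ i₁ → n ≠ i₂ → n ≠ i₃ → n ≠ i₄ →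
      ∀ l, P.crossing (c l) ≠ P.crossing (P.dart d n) := by
    intro n hn n1 n2 n3 n4 l hl
    rcases hr l with h | h
    · have := ha n hn (hl.symm.trans (h.trans e1.symm)); omega
    · have := hb n hn (hl.symm.trans (h.trans e2.symm)); omega
  have s2 := hs.dart_eq_of_forall (d := d) h12 (by rw [e2]; exact hv _ (by simp))
    fun n _ _ => hno n (by omega) (by omega) (by omega) (by omega) (by omega)
  have s3 := hs.dart_eq_of_forall (d := d) h23 (by rw [e3]; exact hv _ (by simp))
    fun n _ _ => hno n (by omega) (by omega) (by omega) (by omega) (by omega)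
  refine (hs.dart_eq_iff (hl.trans e1.symm) (hl.trans e3.symm) fun e => ?_).1 ?_
  · have := P.dart_inj (by omega) (by omega) e; omega
  · rw [s3, s2, add_assoc, CharTwo.add_self_eq_zero, add_zero]

/-- The departures from `a` are four changes of side apart (at `b`, `m`, `b`, `a`), those from `b`
two (at `m`, `b`); both numbers are even. -/
theorem IsCircleThrough.not_sameDirection_of_meets_three {c : Fin 3 → D}
    (hc : P.IsCircleThrough c) {m a b : P.Crossing}
    (hab : ({m, a, b} : Set P.Crossing) = Set.range fun i => P.crossing (c i))
    (h : P.MeetsInCyclicOrder [m, a, b, m, b, a]) {l : Fin 3}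
    (hl : P.crossing (c l) = a ∨ P.crossing (c l) = b) :
    ¬ P.SameDirection (c l) (P.rot (c l)) := by
  obtain ⟨s, hs⟩ := hc.exists_isSide
  obtain ⟨d, i₁, i₂, i₃, i₄, i₅, i₆, h12, h23, h34, h45, h56, hN, e1, e2, e3, e4, e5, e6⟩ := h.six
  have hm := fun n hn => P.eq_or_eq_of_crossing_dart (d := d) (i := i₁) (j := i₄) (k := n)
    (by omega) (by omega) hn (by omega) (e1.trans e4.symm)
  have ha := fun n hn => P.eq_or_eq_of_crossing_dart (d := d) (i := i₂) (j := i₆) (k := n)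
    (by omega) (by omega) hn (by omega) (e2.trans e6.symm)
  have hb := fun n hn => P.eq_or_eq_of_crossing_dart (d := d) (i := i₃) (j := i₅) (k := n)
    (by omega) (by omega) hn (by omega) (e3.trans e5.symm)
  have hr : ∀ i, P.crossing (c i) = m ∨ P.crossing (c i) = a ∨ P.crossing (c i) = b := fun i =>
    hab.symm.subset ⟨i, rfl⟩
  have hv : ∀ v ∈ ({m, a, b} : Set P.Crossing), ∃ l, P.crossing (c l) = v :=
    fun v hv => hab.subset hv
  have hno : ∀ n < P.length, n ≠ i₁ → n ≠ i₂ → n ≠ i₃ → n ≠ i₄ → n ≠ i₅ → n ≠ i₆ →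
      ∀ l, P.crossing (c l) ≠ P.crossing (P.dart d n) := by
    intro n hn n1 n2 n3 n4 n5 n6 l hl
    rcases hr l with h | h | h
    · have := hm n hn (hl.symm.trans (h.trans e1.symm)); omega
    · have := ha n hn (hl.symm.trans (h.trans e2.symm)); omega
    · have := hb n hn (hl.symm.trans (h.trans e3.symm)); omega
  have s3 := hs.dart_eq_of_forall (d := d) h23 (by rw [e3]; exact hv _ (by simp)) fun n _ _ =>
    hno n (by omega) (by omega) (by omega) (by omega) (by omega) (by omega) (by omega)
  have s4 := hs.dart_eq_of_forall (d := d) h34 (by rw [e4]; exact hv _ (by simp)) fun n _ _ =>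
    hno n (by omega) (by omega) (by omega) (by omega) (by omega) (by omega) (by omega)
  have s5 := hs.dart_eq_of_forall (d := d) h45 (by rw [e5]; exact hv _ (by simp)) fun n _ _ =>
    hno n (by omega) (by omega) (by omega) (by omega) (by omega) (by omega) (by omega)
  have s6 := hs.dart_eq_of_forall (d := d) h56 (by rw [e6]; exact hv _ (by simp)) fun n _ _ =>
    hno n (by omega) (by omega) (by omega) (by omega) (by omega) (by omega) (by omega)
  have h2 : ∀ x : ZMod 2, x + 1 + 1 = x := by decide
  rcases hl with hl | hl
  · refine (hs.dart_eq_iff (hl.trans e2.symm) (hl.trans e6.symm) fun e => ?_).1 ?_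
    · have := P.dart_inj (by omega) (by omega) e; omega
    · rw [s6, s5, s4, s3, h2, h2]
  · refine (hs.dart_eq_iff (hl.trans e3.symm) (hl.trans e5.symm) fun e => ?_).1 ?_
    · have := P.dart_inj (by omega) (by omega) e; omega
    · rw [s5, s4, h2]

end KnotProjection

namespace KnotProjection

variable {D : Type*} [Finite D] {P : KnotProjection D}

/-! ### Connectedness of the spliced curve -/

variable (P) in
theorem splicedTurn_of_mem {S : Finset P.Crossing} {d : D} (h : P.crossing d ∈ S) :
    P.splicedTurn S d = P.nonSeifertTurn d := if_pos h

variable (P) in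
theorem splicedTurn_of_not_mem {S : Finset P.Crossing} {d : D} (h : P.crossing d ∉ S) :
    P.splicedTurn S d = P.opp d := if_neg h

variable (P) in
/-- The arms `d` and `e` belong to the same component of `P_S`. -/
def Joined (S : Finset P.Crossing) (d e : D) : Prop :=
  Relation.EqvGen (fun a b => b = P.edge a ∨ b = P.splicedTurn S a) d e

variable {S : Finset P.Crossing}

theorem Joined.symm {d e : D} (h : P.Joined S d e) : P.Joined S e d := Relation.EqvGen.symm _ _ h

theorem Joined.trans {d e f : D} (h : P.Joined S d e) (h' : P.Joined S e f) : P.Joined S d f :=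
  Relation.EqvGen.trans _ _ _ h h'

theorem joined_edge (d : D) : P.Joined S d (P.edge d) := Relation.EqvGen.rel _ _ (Or.inl rfl)

theorem joined_turn (d : D) : P.Joined S d (P.splicedTurn S d) :=
  Relation.EqvGen.rel _ _ (Or.inr rfl)

theorem joined_dart_of_forall {d : D} {i j : ℕ} (hij : i ≤ j)
    (h : ∀ n, i < n → n ≤ j → P.crossing (P.dart d n) ∉ S) :
    P.Joined S (P.dart d i) (P.dart d j) := by
  induction j, hij using Nat.le_induction with
  | base => exact Relation.EqvGen.refl _
  | succ j hij ih =>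
    refine (ih fun n h1 h2 => h n h1 (by omega)).trans ((joined_edge _).trans ?_)
    rw [← opp_dart_succ, ← P.splicedTurn_of_not_mem (h (j + 1) (by omega) le_rfl)]
    exact (joined_turn _).symm

theorem joined_out {d : D} {i j : ℕ} (hi : P.crossing (P.dart d i) ∈ S)
    (hij : P.crossing (P.dart d i) = P.crossing (P.dart d j)) (hne : P.dart d i ≠ P.dart d j) :
    P.Joined S (P.dart d i) (P.dart d j) := by
  rw [← P.nonSeifertTurn_dart hij hne, ← P.splicedTurn_of_mem hi]
  exact joined_turn _

/-- The arm arriving at the point left by dart `i + 1` is the far end of dart `i`, whence the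
shifted indices. -/
theorem joined_in {d : D} {i j : ℕ} (hi : P.crossing (P.dart d (i + 1)) ∈ S)
    (hij : P.crossing (P.dart d (i + 1)) = P.crossing (P.dart d (j + 1)))
    (hne : P.dart d (i + 1) ≠ P.dart d (j + 1)) : P.Joined S (P.dart d i) (P.dart d j) := by
  refine (joined_edge _).trans (Joined.trans ?_ (joined_edge _).symm)
  rw [← opp_dart_succ, ← opp_dart_succ, ← P.nonSeifertTurn_dart hij hne, ← nonSeifertTurn_opp,
    ← P.splicedTurn_of_mem (by rwa [crossing_opp])]
  exact joined_turn _

theorem isOneCurveAfter_of_joined {d e : D} (t : ℕ)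
    (h : ∀ n, t ≤ n → n < t + P.length → P.Joined S e (P.dart d n)) : P.IsOneCurveAfter S := by
  have key : ∀ x, P.SameDirection d x → P.Joined S e x := by
    intro x hx
    obtain ⟨n, hn, rfl⟩ := P.exists_dart_eq ((P.sameDirection_dart d t).symm.trans hx)
    rw [dart_dart]
    exact h _ (by omega) (by omega)
  have key' : ∀ x, P.Joined S e x := by
    intro x
    rcases P.sameDirection_or d x with hx | hx
    · exact key x hx
    · exact (key _ hx).trans (joined_edge x).symm
  exact fun x y => (key' x).symm.trans (key' y)

/-- Two rounds are needed because a round that starts at a double point runs past position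
`P.length`. -/
theorem eq_of_crossing_dart_of_lt {d : D} {i j n : ℕ} (hij : i < j) (hj : j < P.length)
    (h : P.crossing (P.dart d i) = P.crossing (P.dart d j)) (hn : n < 2 * P.length)
    (h' : P.crossing (P.dart d n) = P.crossing (P.dart d i)) :
    n = i ∨ n = j ∨ n = i + P.length ∨ n = j + P.length := by
  rcases lt_or_ge n P.length with hn' | hn'
  · have := P.eq_or_eq_of_crossing_dart (by omega) hj hn' hij.ne h h'
    omega
  · rw [show n = n - P.length + P.length by omega, dart_add_length] at h'
    have := P.eq_or_eq_of_crossing_dart (by omega) hj (by omega) hij.ne h h'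
    omega

variable (P) in
theorem dart_ne_dart {d : D} {i j : ℕ} (hij : i < j) (hj : j < P.length) :
    P.dart d i ≠ P.dart d j := fun e => hij.ne (P.dart_inj (hij.trans hj) hj e)

/-- One non-Seifert splice yields one closed curve. -/
theorem isOneCurveAfter_singleton (a : P.Crossing) : P.IsOneCurveAfter {a} := by
  obtain ⟨d₀⟩ := P.nonempty
  obtain ⟨i, j, hij, hj, rfl, hji⟩ := P.exists_visits d₀ a
  have hno : ∀ n, n < 2 * P.length → n ≠ i → n ≠ j → n ≠ i + P.length → n ≠ j + P.length →
      P.crossing (P.dart d₀ n) ∉ ({P.crossing (P.dart d₀ i)} : Finset P.Crossing) := by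
    intro n hn h1 h2 h3 h4 h
    have := eq_of_crossing_dart_of_lt hij hj hji.symm hn (Finset.mem_singleton.1 h)
    omega
  refine isOneCurveAfter_of_joined (d := d₀) (e := P.dart d₀ i) i fun n h1 h2 => ?_
  rcases lt_or_ge n j with h | h
  · exact joined_dart_of_forall h1 fun k _ _ =>
      hno k (by omega) (by omega) (by omega) (by omega) (by omega)
  · refine (joined_out (Finset.mem_singleton_self _) hji.symm (P.dart_ne_dart hij hj)).trans ?_
    exact joined_dart_of_forall h fun k _ _ =>
      hno k (by omega) (by omega) (by omega) (by omega) (by omega)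

/-- Only the order `a, b, b, a` matters. The visits cut the curve into four arcs, which the splices
reconnect into one curve. -/
theorem MeetsInCyclicOrder.isOneCurveAfter [DecidableEq P.Crossing] {m a b : P.Crossing}
    (h : P.MeetsInCyclicOrder [m, a, b, m, b, a]) : P.IsOneCurveAfter {a, b} := by
  obtain ⟨d, i₀, i, j, i₃, k, l, h01, hij, h23, h34, hkl, hl, -, ei, ej, -, ek, el⟩ := h.six
  have hno : ∀ n, n < 2 * P.length → n ≠ i → n ≠ j → n ≠ k → n ≠ l → n ≠ i + P.length →
      n ≠ j + P.length → n ≠ k + P.length → n ≠ l + P.length →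
      P.crossing (P.dart d n) ∉ ({a, b} : Finset P.Crossing) := by
    intro n hn h1 h2 h3 h4 h5 h6 h7 h8 h
    rcases Finset.mem_insert.1 h with h | h
    · have := eq_of_crossing_dart_of_lt (show i < l by omega) hl (ei.trans el.symm) hn
        (h.trans ei.symm)
      omega
    · have := eq_of_crossing_dart_of_lt (show j < k by omega) (by omega) (ej.trans ek.symm) hn
        ((Finset.mem_singleton.1 h).trans ej.symm)
      omega
  have seg : ∀ x y, x ≤ y → y < 2 * P.length → (∀ n, x < n → n ≤ y → n ≠ i ∧ n ≠ j ∧ n ≠ k ∧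
      n ≠ l ∧ n ≠ i + P.length ∧ n ≠ j + P.length ∧ n ≠ k + P.length ∧ n ≠ l + P.length) →
      P.Joined {a, b} (P.dart d x) (P.dart d y) := by
    intro x y hxy hy hn
    refine joined_dart_of_forall hxy fun n h1 h2 => ?_
    obtain ⟨n1, n2, n3, n4, n5, n6, n7, n8⟩ := hn n h1 h2
    exact hno n (by omega) n1 n2 n3 n4 n5 n6 n7 n8
  have hil : P.Joined {a, b} (P.dart d i) (P.dart d l) :=
    joined_out (by simp [ei]) (ei.trans el.symm) (P.dart_ne_dart (by omega) hl)
  have hjk : P.Joined {a, b} (P.dart d k) (P.dart d j) :=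
    (joined_out (by simp [ej]) (ej.trans ek.symm) (P.dart_ne_dart (by omega) (by omega))).symm
  -- The arc starting at `l` and the arc starting at `k` both end at `a`, where their incoming arms
  -- are joined.
  have hlk : P.Joined {a, b} (P.dart d l) (P.dart d k) := by
    have e1 : i + P.length - 1 + 1 = i + P.length := by omega
    have e2 : l - 1 + 1 = l := by omega
    refine (seg l (i + P.length - 1) (by omega) (by omega) fun n _ _ => by omega).trans ?_
    refine Joined.trans (e := P.dart d (l - 1)) (joined_in ?_ ?_ ?_) ?_
    · rw [e1, dart_add_length, ei]; simp
    · rw [e1, e2, dart_add_length, ei, el]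
    · rw [e1, e2, dart_add_length]; exact P.dart_ne_dart (by omega) hl
    · exact (seg k (l - 1) (by omega) (by omega) fun n _ _ => by omega).symm
  refine isOneCurveAfter_of_joined (d := d) (e := P.dart d i) i fun n h1 h2 => ?_
  rcases lt_or_ge n j with h | hj
  · exact seg _ _ h1 (by omega) fun n _ _ => by omega
  rcases lt_or_ge n k with h | hk
  · exact hil.trans (hlk.trans (hjk.trans (seg _ _ hj (by omega) fun n _ _ => by omega)))
  rcases lt_or_ge n l with h | hl
  · exact hil.trans (hlk.trans (seg _ _ hk (by omega) fun n _ _ => by omega))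
  · exact hil.trans (seg _ _ hl (by omega) fun n _ _ => by omega)

/-- The splices at two interlaced double points yield two curves. -/
theorem MeetsInCyclicOrder.not_isOneCurveAfter [DecidableEq P.Crossing] {a b : P.Crossing}
    (h : P.MeetsInCyclicOrder [a, b, a, b]) : ¬ P.IsOneCurveAfter {a, b} := by
  obtain ⟨d, i, j, k, l, hij, hjk, hkl, hl, ei, ej, ek, el⟩ := h.four
  -- The two arcs from `a` to `b`. Both outgoing arms at `a` and both incoming arms at `b` belong to
  -- them and the other arms at these points do not, so the splices preserve this set.
  let f : D → Prop := fun x => ∃ n < P.length, (i ≤ n ∧ n < j ∨ k ≤ n ∧ n < l) ∧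
    (x = P.dart d n ∨ x = P.edge (P.dart d n))
  have hedge : ∀ x, f (P.edge x) = f x := by
    intro x
    refine propext (exists_congr fun n => and_congr_right fun _ => and_congr_right fun _ => ?_)
    rw [P.edge.injective.eq_iff, or_comm, ← P.edge.injective.eq_iff (a := P.edge x), P.edge_edge]
  have hout : ∀ n < P.length, f (P.dart d n) = (i ≤ n ∧ n < j ∨ k ≤ n ∧ n < l) := by
    intro n hn
    refine propext ⟨?_, fun h => ⟨n, hn, h, Or.inl rfl⟩⟩
    rintro ⟨n', hn', h, e | e⟩
    · rwa [P.dart_inj hn hn' e]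
    · exact absurd e (P.dart_ne_edge_dart d n n')
  have hin : ∀ n < P.length, f (P.opp (P.dart d n)) = (i < n ∧ n ≤ j ∨ k < n ∧ n ≤ l) := by
    intro n hn
    rcases n with _ | n
    · rw [dart_zero, ← P.dart_length d, show P.length = P.length - 1 + 1 by omega, opp_dart_succ,
        hedge, hout _ (by omega)]
      exact propext (by omega)
    · rw [opp_dart_succ, hedge, hout _ (by omega)]
      exact propext (by omega)
  have hik := P.nonSeifertTurn_dart (ei.trans ek.symm) (P.dart_ne_dart (by omega) (by omega))
  have hki := P.nonSeifertTurn_dart (ek.trans ei.symm) (P.dart_ne_dart (by omega) (by omega)).symm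
  have hjl := P.nonSeifertTurn_dart (ej.trans el.symm) (P.dart_ne_dart (by omega) (by omega))
  have hlj := P.nonSeifertTurn_dart (el.trans ej.symm) (P.dart_ne_dart (by omega) (by omega)).symm
  have hturn : ∀ n < P.length, f (P.splicedTurn {a, b} (P.dart d n)) = f (P.dart d n) ∧
      f (P.splicedTurn {a, b} (P.opp (P.dart d n))) = f (P.opp (P.dart d n)) := by
    intro n hn
    by_cases h : P.crossing (P.dart d n) ∈ ({a, b} : Finset P.Crossing)
    · rw [P.splicedTurn_of_mem h, P.splicedTurn_of_mem (by rwa [crossing_opp]), nonSeifertTurn_opp]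
      have : n = i ∨ n = k ∨ n = j ∨ n = l := by
        rcases Finset.mem_insert.1 h with h | h
        · have := P.eq_or_eq_of_crossing_dart (by omega) (by omega) hn (by omega)
            (ei.trans ek.symm) (h.trans ei.symm)
          omega
        · have := P.eq_or_eq_of_crossing_dart (by omega) (by omega) hn (by omega)
            (ej.trans el.symm) ((Finset.mem_singleton.1 h).trans ej.symm)
          omega
      rcases this with rfl | rfl | rfl | rfl
      · rw [hik, hout _ hn, hin _ hn, hout _ (by omega), hin _ (by omega)]
        exact ⟨propext (by omega), propext (by omega)⟩
      · rw [hki, hout _ hn, hin _ hn, hout _ (by omega), hin _ (by omega)]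
        exact ⟨propext (by omega), propext (by omega)⟩
      · rw [hjl, hout _ hn, hin _ hn, hout _ (by omega), hin _ (by omega)]
        exact ⟨propext (by omega), propext (by omega)⟩
      · rw [hlj, hout _ hn, hin _ hn, hout _ (by omega), hin _ (by omega)]
        exact ⟨propext (by omega), propext (by omega)⟩
    · rw [P.splicedTurn_of_not_mem h, P.splicedTurn_of_not_mem (by rwa [crossing_opp]), opp_opp,
        hout _ hn, hin _ hn]
      have h1 : n ≠ i := by rintro rfl; simp [ei] at h
      have h2 : n ≠ j := by rintro rfl; simp [ej] at h
      have h3 : n ≠ k := by rintro rfl; simp [ek] at h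
      have h4 : n ≠ l := by rintro rfl; simp [el] at h
      exact ⟨propext (by omega), propext (by omega)⟩
  intro hone
  have := eq_of_eqvGen (φ := f) (fun x y hxy => ?_) (hone (P.dart d i) (P.dart d j))
  · rw [hout _ (by omega), hout _ (by omega)] at this
    simp at this
    omega
  · rcases hxy with rfl | rfl
    · rw [hedge]
    · rcases em (P.SameDirection d x) with hx | hx
      · obtain ⟨n, hn, rfl⟩ := P.exists_dart_eq hx
        exact (hturn n hn).1.symm
      · obtain ⟨n, hn, e⟩ := P.exists_dart_eq ((P.sameDirection_opp d x).2 hx)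
        rw [← P.opp_opp x, ← e]
        exact (hturn n hn).2.symm

end KnotProjection

namespace KnotProjection

variable {D : Type*} [Finite D] {P : KnotProjection D}

/-! ### The regions after one or two splices -/

theorem not_sameDirection_opp_rot {g : D} (h : ¬ P.SameDirection g (P.rot g)) :
    ¬ P.SameDirection (P.opp g) (P.rot (P.opp g)) := by
  rwa [rot_opp, sameDirection_opp, opp_sameDirection, not_not]

/-- Directions alternate between like and unlike neighbours around a double point, so a splice opens
only one passage, with two opposite corners as its ends. -/
theorem eq_or_eq_opp_of_not_sameDirection {g a : D} (hc : P.crossing g = P.crossing a)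
    (hg : ¬ P.SameDirection g (P.rot g)) (ha : ¬ P.SameDirection a (P.rot a)) :
    a = g ∨ a = P.opp g := by
  have h : P.SameDirection (P.rot g) (P.rot (P.rot g)) := by
    rw [rot_rot, sameDirection_opp]
    exact fun h => hg h.symm
  rcases (P.crossing_eq_iff _ _).1 hc with rfl | rfl | rfl | rfl
  · exact Or.inl rfl
  · exact absurd h ha
  · exact Or.inr rfl
  · refine absurd ?_ ha
    rw [rot_opp, sameDirection_opp, opp_sameDirection, not_not]
    exact h

variable (P) in
theorem exists_corner (v : P.Crossing) : ∃ g, P.crossing g = v ∧ ¬ P.SameDirection g (P.rot g) := by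
  obtain ⟨d, rfl⟩ := Quotient.exists_rep v
  by_cases h : P.SameDirection d (P.rot d)
  · refine ⟨P.rot d, P.crossing_rot d, ?_⟩
    rw [rot_rot, sameDirection_opp, not_not]
    exact h.symm
  · exact ⟨d, rfl, h⟩

theorem SameRegionAfter.of_singleton {a : P.Crossing} {u v : D} (h : P.SameRegionAfter {a} u v)
    (huv : P.face u ≠ P.face v) : ∃ g, P.crossing g = a ∧ ¬ P.SameDirection g (P.rot g) ∧
      P.face u = P.face g ∧ P.face v = P.face (P.opp g) := by
  obtain ⟨g, rfl, hg⟩ := P.exists_corner a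
  -- The region of `u` made explicit: its face or, if that face is an end of the passage, both end
  -- faces.
  have key := eq_of_eqvGen (φ := fun x => P.face u = P.face x ∨
    (P.face u = P.face g ∨ P.face u = P.face (P.opp g)) ∧
      (P.face x = P.face g ∨ P.face x = P.face (P.opp g))) (fun x y hxy => ?_) h
  · simp only [true_or, eq_iff_iff, true_iff] at key
    have hgg := P.opp_opp g
    rcases key with h | ⟨h1 | h1, h2 | h2⟩
    · exact absurd h huv
    · exact absurd (h1.trans h2.symm) huv
    · exact ⟨g, rfl, hg, h1, h2⟩
    · exact ⟨P.opp g, P.crossing_opp g, not_sameDirection_opp_rot hg, h1, by rwa [hgg]⟩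
    · exact absurd (h1.trans h2.symm) huv
  · rcases hxy with hxy | ⟨hx, hd, rfl⟩
    · simp only [hxy]
    · have := P.opp_opp g
      rcases eq_or_eq_opp_of_not_sameDirection (Finset.mem_singleton.1 hx).symm hg hd with rfl | rfl
      · grind
      · grind

theorem SameRegionAfter.of_pair [DecidableEq P.Crossing] {a b : P.Crossing} {u v : D}
    (h : P.SameRegionAfter {a, b} u v) (huv : P.face u ≠ P.face v) :
    ∃ g h, P.crossing g = a ∧ ¬ P.SameDirection g (P.rot g) ∧
      P.crossing h = b ∧ ¬ P.SameDirection h (P.rot h) ∧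
      (P.face u = P.face g ∧ P.face v = P.face (P.opp g) ∨
       P.face u = P.face h ∧ P.face v = P.face (P.opp h) ∨
       P.face u = P.face g ∧ P.face (P.opp g) = P.face h ∧ P.face v = P.face (P.opp h) ∨
       P.face u = P.face h ∧ P.face (P.opp h) = P.face g ∧ P.face v = P.face (P.opp g)) := by
  obtain ⟨g, rfl, hg⟩ := P.exists_corner a
  obtain ⟨k, rfl, hk⟩ := P.exists_corner b
  have hgg := P.opp_opp g
  have hkk := P.opp_opp k
  -- A corner in the region of `u` lies in the same face, or is linked by one passage, or the two
  -- passages share a face and both corners lie in end faces of them.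
  have key := eq_of_eqvGen (φ := fun x => P.face u = P.face x ∨
    (P.face u = P.face g ∨ P.face u = P.face (P.opp g)) ∧
      (P.face x = P.face g ∨ P.face x = P.face (P.opp g)) ∨
    (P.face u = P.face k ∨ P.face u = P.face (P.opp k)) ∧
      (P.face x = P.face k ∨ P.face x = P.face (P.opp k)) ∨
    (P.face g = P.face k ∨ P.face g = P.face (P.opp k) ∨ P.face (P.opp g) = P.face k ∨
      P.face (P.opp g) = P.face (P.opp k)) ∧
    (P.face u = P.face g ∨ P.face u = P.face (P.opp g) ∨
      P.face u = P.face k ∨ P.face u = P.face (P.opp k)) ∧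
    (P.face x = P.face g ∨ P.face x = P.face (P.opp g) ∨
      P.face x = P.face k ∨ P.face x = P.face (P.opp k))) (fun x y hxy => ?_) h
  · simp only [true_or, eq_iff_iff, true_iff] at key
    have hg' := not_sameDirection_opp_rot hg
    have hk' := not_sameDirection_opp_rot hk
    have cg := P.crossing_opp g
    have ck := P.crossing_opp k
    have goal : ∃ g', (g' = g ∨ g' = P.opp g) ∧ ∃ k', (k' = k ∨ k' = P.opp k) ∧
        (P.face u = P.face g' ∧ P.face v = P.face (P.opp g') ∨
         P.face u = P.face k' ∧ P.face v = P.face (P.opp k') ∨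
         P.face u = P.face g' ∧ P.face (P.opp g') = P.face k' ∧ P.face v = P.face (P.opp k') ∨
         P.face u = P.face k' ∧ P.face (P.opp k') = P.face g' ∧ P.face v = P.face (P.opp g')) := by
      simp only [or_and_right, exists_or, exists_eq_left, hgg, hkk]
      clear h hg hk hg' hk' cg ck hgg hkk
      generalize P.face g = g1 at *
      generalize P.face (P.opp g) = g2 at *
      generalize P.face k = k1 at *
      generalize P.face (P.opp k) = k2 at *
      generalize P.face u = fu at *
      generalize P.face v = fv at *
      grind (splits := 20)
    obtain ⟨g', hg1, k', hk1, h⟩ := goal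
    refine ⟨g', k', ?_, ?_, ?_, ?_, h⟩
    · rcases hg1 with rfl | rfl <;> simp [cg]
    · rcases hg1 with rfl | rfl <;> assumption
    · rcases hk1 with rfl | rfl <;> simp [ck]
    · rcases hk1 with rfl | rfl <;> assumption
  · rcases hxy with hxy | ⟨hx, hd, rfl⟩
    · simp only [hxy]
    · clear huv h
      rcases Finset.mem_insert.1 hx with hx | hx
      · rcases eq_or_eq_opp_of_not_sameDirection hx.symm hg hd with rfl | rfl
        · clear hd hx hg hk hkk hgg
          grind
        · rw [hgg]
          clear hd hx hg hk hkk hgg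
          grind
      · rcases eq_or_eq_opp_of_not_sameDirection (Finset.mem_singleton.1 hx).symm hk hd with
          rfl | rfl
        · clear hd hx hg hk hkk hgg
          grind
        · rw [hkk]
          clear hd hx hg hk hkk hgg
          grind

/-! ### Circles and splices -/

theorem face_ne_face_opp (hP : ¬ P.IsReducible) (d : D) : P.face d ≠ P.face (P.opp d) := by
  intro h
  refine hP ⟨fun x y => ?_, P.crossing d, Finset.notMem_empty _, d, rfl,
    Relation.EqvGen.rel _ _ (Or.inl h)⟩
  refine (P.one_component x y).mono fun a b hab => ?_
  rwa [P.splicedTurn_of_not_mem (Finset.notMem_empty _)]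

theorem hasTwoPointCircle_of_corners (hP : ¬ P.IsReducible) {u g : D}
    (hc : P.crossing g ≠ P.crossing u) (hg : ¬ P.SameDirection g (P.rot g))
    (h1 : P.face u = P.face g) (h2 : P.face (P.opp u) = P.face (P.opp g)) :
    P.HasTwoPointCircle := by
  -- The circle leaves the point of `g` through the corner `g` and enters the point of `u` through
  -- the corner `u` of the same face.
  have hcirc : P.IsCircleThrough ![g, P.opp u] := by
    refine ⟨?_, ?_, ?_⟩
    · intro i j h
      fin_cases i <;> fin_cases j <;> simp [crossing_opp, hc, hc.symm] at h ⊢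
    · have := face_ne_face_opp hP u
      intro i j h
      fin_cases i <;> fin_cases j <;> simp [← h1, this, this.symm] at h ⊢
    · intro i
      fin_cases i <;> simp [opp_opp, h1, h2]
  refine ⟨_, hcirc, P.crossing g, P.crossing u, ?_, ?_⟩
  · ext x
    simp [crossing_opp, eq_comm]
  · simpa [crossing_opp] using hcirc.meets_of_two hg

theorem hasThreePointCircle_of_corners [DecidableEq P.Crossing] (hP : ¬ P.IsReducible) {u g h : D}
    (hug : P.crossing g ≠ P.crossing u) (huh : P.crossing h ≠ P.crossing u)
    (hgh : P.crossing g ≠ P.crossing h)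
    (hg : ¬ P.SameDirection g (P.rot g)) (hh : ¬ P.SameDirection h (P.rot h))
    (h1 : P.face u = P.face g) (h2 : P.face (P.opp g) = P.face h)
    (h3 : P.face (P.opp u) = P.face (P.opp h))
    (hone : P.IsOneCurveAfter {P.crossing g, P.crossing h}) : P.HasThreePointCircle := by
  have hcirc : P.IsCircleThrough ![u, P.opp g, P.opp h] := by
    refine ⟨?_, ?_, ?_⟩
    · intro i j h
      fin_cases i <;> fin_cases j <;>
        simp [crossing_opp, hug, huh, hgh, hug.symm, huh.symm, hgh.symm] at h ⊢
    -- Any two of the three faces contain opposite corners at one of the three points, so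
    -- reducedness makes them distinct.
    · have e1 := face_ne_face_opp hP u
      have e2 := face_ne_face_opp hP g
      have e3 := face_ne_face_opp hP h
      rw [h3] at e1
      rw [← h1] at e2
      rw [← h2] at e3
      intro i j h
      fin_cases i <;> fin_cases j <;> simp [e1, e2, e3, e1.symm, e2.symm, e3.symm] at h ⊢
    · intro i
      fin_cases i <;> simp [opp_opp, h1, h2, h3]
  refine ⟨_, hcirc, P.crossing u, P.crossing g, P.crossing h, ?_, ?_⟩
  · ext x
    simp [crossing_opp, Fin.exists_fin_succ, eq_comm]
  · simpa [crossing_opp] using hcirc.meets_of_three (not_sameDirection_opp_rot hg)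
      (not_sameDirection_opp_rot hh)
      (by simpa [crossing_opp] using fun hm => MeetsInCyclicOrder.not_isOneCurveAfter hm hone)

theorem hasTwoPointCircle_of_isReducibleAfter (hP : ¬ P.IsReducible) {a : P.Crossing}
    (h : P.IsReducibleAfter {a}) : P.HasTwoPointCircle := by
  obtain ⟨-, v, hv, u, rfl, hr⟩ := h
  obtain ⟨g, rfl, hg, h1, h2⟩ := hr.of_singleton (face_ne_face_opp hP u)
  exact hasTwoPointCircle_of_corners hP (fun e => hv (by simp [e])) hg h1 h2

/-- Splicing `a` opens the passage used by the circle, which then meets the new curve only in `b`.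
-/
theorem HasTwoPointCircle.exists_isReducibleAfter (h : P.HasTwoPointCircle) :
    ∃ a : P.Crossing, P.IsReducibleAfter {a} := by
  obtain ⟨c, hc, a, b, hab, hm⟩ := h
  obtain ⟨l, hl⟩ : ∃ l, P.crossing (c l) = a := hab.subset (by simp)
  have hd := hc.not_sameDirection_of_meets_two hab hm hl
  have hl2 : l + 1 + 1 = l := by fin_cases l <;> rfl
  have hl1 : l + 1 ≠ l := by fin_cases l <;> decide
  have h1 := hc.2.2 l
  have h2 := hc.2.2 (l + 1)
  rw [hl2] at h2
  refine ⟨a, isOneCurveAfter_singleton a, P.crossing (c (l + 1)), ?_, c (l + 1), rfl, ?_⟩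
  · rw [Finset.mem_singleton, ← hl]
    exact fun e => hl1 (hc.1 e)
  · have r1 : P.SameRegionAfter {a} (c (l + 1)) (P.opp (c l)) :=
      Relation.EqvGen.rel _ _ (Or.inl h2)
    have r2 : P.SameRegionAfter {a} (c l) (P.opp (c l)) :=
      Relation.EqvGen.rel _ _ (Or.inr ⟨by simp [hl], hd, rfl⟩)
    have r3 : P.SameRegionAfter {a} (c l) (P.opp (c (l + 1))) :=
      Relation.EqvGen.rel _ _ (Or.inl h1)
    exact Relation.EqvGen.trans _ _ _ r1
      (Relation.EqvGen.trans _ _ _ (Relation.EqvGen.symm _ _ r2) r3)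

/-- After splicing `a` and `b` the circle meets the curve only in `m`. -/
theorem HasThreePointCircle.exists_isReducibleAfter [DecidableEq P.Crossing]
    (h : P.HasThreePointCircle) : ∃ a b : P.Crossing, P.IsReducibleAfter {a, b} := by
  obtain ⟨c, hc, m, a, b, hab, hm⟩ := h
  obtain ⟨l, hl⟩ : ∃ l, P.crossing (c l) = m := hab.subset (by simp)
  have hd := fun i => hc.not_sameDirection_of_meets_three hab hm (l := i)
  have hr : ∀ i, i ≠ l → P.crossing (c i) = a ∨ P.crossing (c i) = b := by
    intro i hi
    rcases hab.symm.subset ⟨i, rfl⟩ with h | h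
    · exact absurd (hc.1 (h.trans hl.symm)) hi
    · exact h
  have hl3 : l + 1 + 1 + 1 = l := by fin_cases l <;> rfl
  have hl1 : l + 1 ≠ l := by fin_cases l <;> decide
  have hl2 : l + 1 + 1 ≠ l := by fin_cases l <;> decide
  have hpass : ∀ i, i ≠ l → P.SameRegionAfter {a, b} (P.opp (c i)) (c i) := fun i hi =>
    Relation.EqvGen.symm _ _ (Relation.EqvGen.rel _ _
      (Or.inr ⟨by simpa using hr i hi, hd i (hr i hi), rfl⟩))
  have hface : ∀ i, P.SameRegionAfter {a, b} (c i) (P.opp (c (i + 1))) := fun i =>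
    Relation.EqvGen.rel _ _ (Or.inl (hc.2.2 i))
  refine ⟨a, b, hm.isOneCurveAfter, m, ?_, c l, hl, ?_⟩
  -- The circle has three distinct points, so `m` is not spliced.
  · have hinv : ∀ v ∈ ({a, b} : Set P.Crossing), m ≠ v := by
      rintro v hv rfl
      have hcard : Set.ncard ({m, a, b} : Set P.Crossing) = 3 := by
        rw [hab, ← Set.image_univ, Set.ncard_image_of_injective _ hc.1]
        simp
      rw [Set.insert_eq_of_mem hv] at hcard
      have := Set.ncard_insert_le a {b}
      rw [Set.ncard_singleton] at this
      omega
    intro hmem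
    exact hinv m (by simpa using hmem) rfl
  · have h3 := hface (l + 1 + 1)
    rw [hl3] at h3
    exact Relation.EqvGen.trans _ _ _ (hface l) (Relation.EqvGen.trans _ _ _ (hpass _ hl1)
      (Relation.EqvGen.trans _ _ _ (hface _) (Relation.EqvGen.trans _ _ _ (hpass _ hl2) h3)))

/-- A chain using only one passage would give the excluded two-point circle, so both passages are
used, in one order or the other. -/
theorem hasThreePointCircle_of_isReducibleAfter [DecidableEq P.Crossing] (hP : ¬ P.IsReducible)
    (h2 : ¬ P.HasTwoPointCircle) {a b : P.Crossing} (hab : a ≠ b)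
    (h : P.IsReducibleAfter {a, b}) : P.HasThreePointCircle := by
  obtain ⟨hone, v, hv, u, rfl, hr⟩ := h
  obtain ⟨g, k, rfl, hg, rfl, hk, h⟩ := hr.of_pair (face_ne_face_opp hP u)
  have hgu : P.crossing g ≠ P.crossing u := fun e => hv (by simp [e])
  have hku : P.crossing k ≠ P.crossing u := fun e => hv (by simp [e])
  rcases h with ⟨e1, e2⟩ | ⟨e1, e2⟩ | ⟨e1, e2, e3⟩ | ⟨e1, e2, e3⟩
  · exact absurd (hasTwoPointCircle_of_corners hP hgu hg e1 e2) h2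
  · exact absurd (hasTwoPointCircle_of_corners hP hku hk e1 e2) h2
  · exact hasThreePointCircle_of_corners hP hgu hku hab hg hk e1 e2 e3 hone
  · exact hasThreePointCircle_of_corners hP hku hgu hab.symm hk hg e1 e2 e3
      (by rwa [Finset.pair_comm])

/-! ### Bounds for `y` and the theorem -/

theorem y_le {S : Finset P.Crossing} (h : P.IsReducibleAfter S) : P.y ≤ S.card :=
  iInf₂_le S h

theorem two_le_y_iff (hP : ¬ P.IsReducible) : 2 ≤ P.y ↔ ¬ P.HasTwoPointCircle := by
  constructor
  · intro h h2
    obtain ⟨a, ha⟩ := h2.exists_isReducibleAfter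
    have := h.trans (y_le ha)
    rw [Finset.card_singleton] at this
    exact absurd this (by norm_num)
  · intro h
    refine le_iInf₂ fun S hS => ?_
    by_contra hlt
    have hlt' : S.card < 2 := by
      rw [not_le] at hlt
      exact_mod_cast hlt
    have : S.card = 0 ∨ S.card = 1 := by omega
    rcases this with h0 | h1
    · rw [Finset.card_eq_zero.1 h0] at hS
      exact hP hS
    · obtain ⟨a, rfl⟩ := Finset.card_eq_one.1 h1
      exact h (hasTwoPointCircle_of_isReducibleAfter hP hS)

end KnotProjection

theorem mainTheorem3 {D : Type*} [Finite D] (P : KnotProjection D) (hP : ¬ P.IsReducible) :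
    P.y = 2 ↔ ¬ P.HasTwoPointCircle ∧ P.HasThreePointCircle := by
  classical
  rw [← KnotProjection.two_le_y_iff hP]
  constructor
  · intro h
    refine ⟨h.ge, ?_⟩
    have h2 := (KnotProjection.two_le_y_iff hP).1 h.ge
    have hlt : P.y < 3 := by rw [h]; norm_num
    -- An infimum below 3 is undercut by some admissible set, which therefore has exactly two
    -- points.
    obtain ⟨S, hlt⟩ := iInf_lt_iff.1 hlt
    obtain ⟨hS, hlt⟩ := iInf_lt_iff.1 hlt
    have hle := KnotProjection.y_le hS
    rw [h] at hle
    have hlt' : S.card < 3 := by exact_mod_cast hlt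
    have hle' : 2 ≤ S.card := by exact_mod_cast hle
    obtain ⟨a, b, hab, rfl⟩ := Finset.card_eq_two.1 (show S.card = 2 by omega)
    exact KnotProjection.hasThreePointCircle_of_isReducibleAfter hP h2 hab hS
  · rintro ⟨h2, h3⟩
    obtain ⟨a, b, hab⟩ := h3.exists_isReducibleAfter
    refine le_antisymm ((KnotProjection.y_le hab).trans ?_) h2
    -- The bound on the size of `{a, b}` does not need `a ≠ b`.
    exact_mod_cast Finset.card_le_two
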